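/- **Setting.** Let $d,r\in\mathbb N$, let $Q^*_1,\dots,Q^*_d\in\mathbb R^{r\times r}$ be symmetric matrices, and let $S\in\mathbb R^{d\times d}$, $T\in\mathbb R^{d\times d\times d}$ and $\eta\ge 0$ satisfy $|S_{a,b}-\mathrm{Tr}(Q^*_aQ^*_b)|\le\eta$ and $|T_{a,b,c}-\mathrm{Tr}(Q^*_aQ^*_bQ^*_c)|\le\eta$ for all $a,b,c\in[d]$. Let $\beta\ge 1$ and $\kappa>0$ be such that $\|Q^*_a\|_F\le\beta$ for all $a$, and $\sigma_{\binom{r+1}{2}}(M^*)\ge\kappa$, where $M^*\in\mathbb R^{d\times\binom{r+1}{2}}$ has entries $M^*_{a,(i_1,i_2)}=(Q^*_a)_{i_1i_2}$ for $1\le i_1\le i_2\le r$ and $\sigma_i$ denotes the $i$-th largest singular value. For $\lambda,\mu\in\mathbb S^{d-1}$ put $Q^*_\lambda=\sum_a\lambda_aQ^*_a$ and $Q^*_\mu=\sum_a\mu_aQ^*_a$. For $\upsilon>0$, call $\lambda,\mu$ *$\upsilon$-non-degenerate combinations* of the $Q^*_a$ if $Q^*_\lambda=V^\top\Lambda V$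 with $V$ orthogonal and $\Lambda$ diagonal, where any two diagonal entries of $\Lambda$ (in different positions) differ by at least $\upsilon$ and every entry of $VQ^*_\mu V^\top$ has absolute value at least $\upsilon$. The ground truth is normalized (by a joint conjugation $Q^*_a\mapsto VQ^*_aV^\top$ with $V\in O(r)$) so that $Q^*_\lambda$ is diagonal with nondecreasing diagonal entries and $(Q^*_\mu)_{1j}\ge 0$ for $2\le j\le r$. **Program.** The indeterminates are the entries of $r\times r$ matrices $Q_1,\dots,Q_d$ and of a $\binom{r+1}{2}\times d$ matrix $L$. Let $M$ be the $d\times\binom{r+1}{2}$ matrix with entries $(Q_a)_{i_1i_2}$, $i_1\le i_2$, and let $Q_\lambda=\sum_a\lambda_aQ_a$, $Q_\mu=\sum_a\mu_aQ_a$. The constraints are: $Q_a=Q_a^\top$; $-\eta\le\mathrm{Tr}(Q_aQ_b)-S_{a,b}\le\eta$; $-\eta\le\mathrm{Tr}(Q_aQ_bQ_c)-T_{a,b,c}\le\eta$; $\|Q_a\|_F^2\le\beta^2$; $LM=\mathrm{Id}$; $\|L\|_F^2\le r^2/\kappa^2$; $(Q_\lambda)_{ij}=0$ for $i\ne j$;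 $(Q_\lambda)_{jj}\ge(Q_\lambda)_{ii}$ for $j>i$; $(Q_\mu)_{1j}\ge 0$ for all $j\in[r]$. A degree-$D$ pseudo-expectation is a linear functional $\tilde{\mathbb E}$ on the polynomials of degree at most $D$ with $\tilde{\mathbb E}[1]=1$ and $\tilde{\mathbb E}[p^2]\ge 0$ whenever $\deg p\le D/2$. It satisfies a program with constraints $p_i\ge 0$, $q_j=0$ if $\tilde{\mathbb E}[s\prod_{i\in I}p_i]\ge 0$ for every finite multiset $I$ and every sum of squares $s$ with $\deg(s\prod_{i\in I}p_i)\le D$, and $\tilde{\mathbb E}[hq_j]=0$ for all $j$ and all polynomials $h$ with $\deg(hq_j)\le D$. **Theorem 7.5.** There are a real polynomial $P$ in five variables and a constant $c>0$, both absolute, such that the following holds for all data as above. If $\lambda,\mu\in\mathbb S^{d-1}$ are $\upsilon$-non-degenerate combinations of $Q^*_1,\dots,Q^*_d$ for some $\upsilon>0$ and the $Q^*_a$ are normalized as above, then every degree-$96$ pseudo-expectation $\tilde{\mathbb E}$ satisfying the program has $$\|\tilde{\mathbb E}[Q_a]-Q^*_a\|_F\le P(d,r,\beta,1/\kappa,1/\upsilon)\cdot\eta^c\qquad\text{for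 all }a\in[d].$$ -/

import Mathlib

open MvPolynomial

noncomputable section

namespace TensorRing

/-! ### Pseudo-expectations -/

/-- A system of polynomial constraints `p ≥ 0` (for `p ∈ ineqs`) and `q = 0` (for `q ∈ eqs`). -/
structure PolyProgram (σ : Type) where
  ineqs : Set (MvPolynomial σ ℝ)
  eqs : Set (MvPolynomial σ ℝ)

/-- `E` is a degree-`D` pseudo-expectation. Such an object is a linear functional on the polynomials
of degree at most `D`. Every linear functional on that subspace extends linearly to all polynomials,
and only values at polynomials of degree at most `D` are constrained or used, so we let `E` be
defined on all polynomials. -/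
structure IsPseudoExpectation {σ : Type} (D : ℕ) (E : MvPolynomial σ ℝ →ₗ[ℝ] ℝ) : Prop where
  normalized : E 1 = 1
  sq_nonneg : ∀ p : MvPolynomial σ ℝ, 2 * p.totalDegree ≤ D → 0 ≤ E (p ^ 2)

/-- The degree-`D` pseudo-expectation `E` satisfies the program `P`: it is nonnegative on every
product, of degree at most `D`, of a sum of squares with a finite multiset of inequality
constraints, and it vanishes on the ideal generated by the equality constraints at degree `D`, that
is on the combinations of multiples `h * q` (with `q` an equality constraint) of degree at
most `D`. -/
structure Satisfies {σ : Type} (D : ℕ) (E : MvPolynomial σ ℝ →ₗ[ℝ] ℝ) (P : PolyProgram σ) :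
    Prop where
  ineq : ∀ S : Multiset (MvPolynomial σ ℝ), (∀ p ∈ S, p ∈ P.ineqs) →
    ∀ s : MvPolynomial σ ℝ, IsSumSq s → (s * S.prod).totalDegree ≤ D → 0 ≤ E (s * S.prod)
  eq : ∀ f ∈ Submodule.span ℝ
      {g : MvPolynomial σ ℝ | g.totalDegree ≤ D ∧ ∃ h, ∃ q ∈ P.eqs, g = h * q}, E f = 0

/-! ### The ground truth -/

/-- The Frobenius norm of a real square matrix. -/
def frobNorm {r : ℕ} (A : Matrix (Fin r) (Fin r) ℝ) : ℝ :=
  Real.sqrt (∑ i, ∑ j, A i j ^ 2)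

/-- Index pairs `(i₁, i₂)` with `i₁ ≤ i₂`; there are `(r + 1).choose 2` of them. -/
abbrev UpperPairs (r : ℕ) : Type := {p : Fin r × Fin r // p.1 ≤ p.2}

/-- The matrix with rows indexed by `a` and columns by pairs `i₁ ≤ i₂`, with entries
`(Q a) i₁ i₂`. -/
def upperMatrix {R : Type} {d r : ℕ} (Q : Fin d → Matrix (Fin r) (Fin r) R) :
    Matrix (Fin d) (UpperPairs r) R :=
  Matrix.of fun a p => Q a p.1.1 p.1.2

/-- The `i`-th largest singular value of a real matrix, `i = 1, 2, …` (Mathlib counts singular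
values from `0`). -/
def singularValue {m n : Type} [Fintype m] [Fintype n] [DecidableEq n]
    (M : Matrix m n ℝ) (i : ℕ) : ℝ :=
  (Matrix.toEuclideanLin M).singularValues (i - 1)

/-- Scaling and condition number assumptions on the ground truth. -/
structure RingAssumption {d r : ℕ} (Qs : Fin d → Matrix (Fin r) (Fin r) ℝ) (β κ : ℝ) : Prop where
  scaling : ∀ a, frobNorm (Qs a) ≤ β
  condition : κ ≤ singularValue (upperMatrix Qs) ((r + 1).choose 2)

/-- `S` and `T` are the second and third order moments of the ground truth up to error `η`. -/
structure MomentsMatch {d r : ℕ} (Qs : Fin d → Matrix (Fin r) (Fin r) ℝ)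
    (S : Fin d → Fin d → ℝ) (T : Fin d → Fin d → Fin d → ℝ) (η : ℝ) : Prop where
  second : ∀ a b, |S a b - (Qs a * Qs b).trace| ≤ η
  third : ∀ a b c, |T a b c - (Qs a * Qs b * Qs c).trace| ≤ η

/-- The linear combination `∑ a, c a • Qs a`. -/
def combo {d r : ℕ} (c : EuclideanSpace ℝ (Fin d)) (Qs : Fin d → Matrix (Fin r) (Fin r) ℝ) :
    Matrix (Fin r) (Fin r) ℝ :=
  ∑ a, c a • Qs a

/-- `lam`, `mu` are `υ`-non-degenerate combinations of the symmetric matrices `Qs a`: there is an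
orthogonal eigendecomposition `Vᵀ Λ V` of `Q_lam` whose eigenvalues are pairwise at distance at least
`υ`, and all entries of `V Q_mu Vᵀ` have magnitude at least `υ`. (For `υ > 0` the decomposition is
unique up to order and signs, which do not affect these conditions.) -/
def NonDegenerate {d r : ℕ} (υ : ℝ) (lam mu : EuclideanSpace ℝ (Fin d))
    (Qs : Fin d → Matrix (Fin r) (Fin r) ℝ) : Prop :=
  ∃ V ∈ Matrix.orthogonalGroup (Fin r) ℝ, ∃ ev : Fin r → ℝ,
    combo lam Qs = V.transpose * Matrix.diagonal ev * V ∧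
    (∀ i j, i ≠ j → υ ≤ |ev i - ev j|) ∧
    ∀ i j, υ ≤ |(V * combo mu Qs * V.transpose) i j|

/-- The normalization that fixes the joint rotation `Q a ↦ V Q a Vᵀ` of the ground truth:
`Q_lam` is diagonal with nondecreasing diagonal, and the entries of the first row of `Q_mu` to the
right of the diagonal are nonnegative. -/
structure GaugeFixed {d r : ℕ} (lam mu : EuclideanSpace ℝ (Fin d))
    (Qs : Fin d → Matrix (Fin r) (Fin r) ℝ) : Prop where
  diag : ∀ i j, i ≠ j → combo lam Qs i j = 0
  sorted : ∀ i j, i < j → combo lam Qs i i ≤ combo lam Qs j j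
  firstRow : ∀ i j : Fin r, i.val = 0 → i < j → 0 ≤ combo mu Qs i j

/-! ### The sum-of-squares program -/

/-- The scalar indeterminates: the entries of the `d` matrices `Q a` of size `r × r`, and the entries
of the matrix `L`, with rows indexed by pairs `i₁ ≤ i₂` and columns by `a`. -/
inductive RingVar (d r : ℕ) : Type
  | Q (a : Fin d) (i j : Fin r) : RingVar d r
  | L (p : UpperPairs r) (a : Fin d) : RingVar d r

/-- The matrix of indeterminates `Q a`. -/
def varQ {d r : ℕ} (a : Fin d) : Matrix (Fin r) (Fin r) (MvPolynomial (RingVar d r) ℝ) :=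
  Matrix.of fun i j => X (RingVar.Q a i j)

/-- The matrix of indeterminates `L`. -/
def varL {d r : ℕ} : Matrix (UpperPairs r) (Fin d) (MvPolynomial (RingVar d r) ℝ) :=
  Matrix.of fun p a => X (RingVar.L p a)

/-- The matrix of linear forms `∑ a, c a • Q a`. -/
def varCombo {d r : ℕ} (c : EuclideanSpace ℝ (Fin d)) :
    Matrix (Fin r) (Fin r) (MvPolynomial (RingVar d r) ℝ) :=
  ∑ a, c a • varQ a

/-- The polynomials constrained to be nonnegative. -/
inductive RingIneq {d r : ℕ} (lam mu : EuclideanSpace ℝ (Fin d)) (S : Fin d → Fin d → ℝ)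
    (T : Fin d → Fin d → Fin d → ℝ) (β κ η : ℝ) : MvPolynomial (RingVar d r) ℝ → Prop
  | second_lower (a b : Fin d) : RingIneq lam mu S T β κ η
      ((varQ a * varQ b).trace - C (S a b) + C η)
  | second_upper (a b : Fin d) : RingIneq lam mu S T β κ η
      (C η - ((varQ a * varQ b).trace - C (S a b)))
  | third_lower (a b c : Fin d) : RingIneq lam mu S T β κ η
      ((varQ a * varQ b * varQ c).trace - C (T a b c) + C η)
  | third_upper (a b c : Fin d) : RingIneq lam mu S T β κ η
      (C η - ((varQ a * varQ b * varQ c).trace - C (T a b c)))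
  | bounded_Q (a : Fin d) : RingIneq lam mu S T β κ η
      (C (β ^ 2) - ∑ i, ∑ j, varQ a i j ^ 2)
  | bounded_L : RingIneq lam mu S T β κ η
      (C ((r : ℝ) ^ 2 / κ ^ 2) - ∑ p, ∑ a, varL p a ^ 2)
  | sorted (i j : Fin r) (h : i < j) : RingIneq lam mu S T β κ η
      (varCombo lam j j - varCombo lam i i)
  | firstRow (i j : Fin r) (h : i.val = 0) : RingIneq lam mu S T β κ η
      (varCombo mu i j)

/-- The polynomials constrained to vanish; `leftInverse` says that `L * M = 1`, where `M` is the matrix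
of upper triangular entries of the `Q a`. -/
inductive RingEq {d r : ℕ} (lam : EuclideanSpace ℝ (Fin d)) :
    MvPolynomial (RingVar d r) ℝ → Prop
  | symm (a : Fin d) (i j : Fin r) : RingEq lam (varQ a i j - varQ a j i)
  | leftInverse (p q : UpperPairs r) : RingEq lam
      (∑ a, varL p a * upperMatrix varQ a q - if p = q then 1 else 0)
  | diag (i j : Fin r) (h : i ≠ j) : RingEq lam (varCombo lam i j)

/-- The sum-of-squares program for tensor ring decomposition. -/
def ringProgram {d r : ℕ} (lam mu : EuclideanSpace ℝ (Fin d)) (S : Fin d → Fin d → ℝ)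
    (T : Fin d → Fin d → Fin d → ℝ) (β κ η : ℝ) : PolyProgram (RingVar d r) where
  ineqs := {p | RingIneq lam mu S T β κ η p}
  eqs := {p | RingEq lam p}

/-- The real matrix of pseudo-expectations of the entries of `Q a`. -/
def pseudoMean {d r : ℕ} (E : MvPolynomial (RingVar d r) ℝ →ₗ[ℝ] ℝ) (a : Fin d) :
    Matrix (Fin r) (Fin r) ℝ :=
  Matrix.of fun i j => E (varQ a i j)

end TensorRing

end

/-! The condition on the singular values says that the ground-truth matrices span the symmetric
matrices, with coefficients of size at most `1 / κ`. So each symmetric unit $E_{ij}$ is a bounded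
combination $\sum_a c_{ij,a}Q^*_a$, and the linear rule $\varphi: Q^*_a\mapsto Q_a$ can be evaluated
on it. The goal is $\varphi(E_{ij})\approx E_{ij}$; expanding $Q^*_a$ in units then gives
$Q_a\approx Q^*_a$. Here $f\approx 0$ means that multiplication by $f$ is small for the seminorm
$\sqrt{\tilde{\mathbb E}[p^2]}$. Such bounds can be added and multiplied, so they behave like
ordinary error terms as long as degrees fit.

Second and third moments make $\varphi$ an approximate Jordan homomorphism
(`ApproxSolution.jordan`): if $uv+vu=2w$ in the truth, then
$X=\varphi(u)\varphi(v)+\varphi(v)\varphi(u)-2\varphi(w)$ is symmetric and nearly trace-orthogonal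
to all $Q_a$, and the left inverse $L$ then forces $X\approx0$.

Diagonal units: let $w_{kj}$ be the squared norm of row $k$ of $\varphi(E_{jj})$. Idempotence and
the trace make $w$ nearly doubly stochastic. Since $Q_\lambda$ is diagonal, $w_{kj}$ nearly vanishes
unless the $k$-th diagonal entry of $Q_\lambda$ is the $j$-th true eigenvalue. Both sequences are
sorted, so products $w_{kj}w_{lm}$ over inversions are small (`inversion_small`), and a counting
argument of Hall type leaves only the identity permutation (`rowWeight_small`).

Off-diagonal units: Jordan relations with the $E_{ii}$ confine $\varphi(E_{ij})$ to the positions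
$(i,j),(j,i)$, and its square fixes the entry there up to sign. Nonnegativity of the first row of
$Q_\mu$ fixes the signs in that row (`scalar_firstRow`), and
$E_{zj}E_{zk}+E_{zk}E_{zj}=\frac12E_{jk}$ carries them to all pairs. Each of the two passages from a
small square to a small polynomial costs a square root of the error, whence the exponent $1/4$. -/

noncomputable section

namespace TensorRing

/-! ### Operator bounds under a pseudo-expectation -/

section OperatorBounds

variable {σ : Type} {E : MvPolynomial σ ℝ →ₗ[ℝ] ℝ}

/-- Multiplication by `f`, a polynomial of degree at most `k`, increases the seminorm
`p ↦ √(E (p ^ 2))` by at most the factor `b`, as long as degrees stay at most `48`. -/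
structure OpBound (E : MvPolynomial σ ℝ →ₗ[ℝ] ℝ) (k : ℕ) (b : ℝ) (f : MvPolynomial σ ℝ) :
    Prop where
  nonneg : 0 ≤ b
  degree : f.totalDegree ≤ k
  bound : ∀ p : MvPolynomial σ ℝ, p.totalDegree + k ≤ 48 → E (p ^ 2 * f ^ 2) ≤ b ^ 2 * E (p ^ 2)

theorem IsPseudoExpectation.nonneg_sq (hE : IsPseudoExpectation 96 E) {p : MvPolynomial σ ℝ}
    (hp : p.totalDegree ≤ 48) : 0 ≤ E (p ^ 2) :=
  hE.sq_nonneg p (by omega)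

theorem totalDegree_mul_le {p q : MvPolynomial σ ℝ} {k l : ℕ} (hp : p.totalDegree ≤ k)
    (hq : q.totalDegree ≤ l) : (p * q).totalDegree ≤ k + l :=
  (totalDegree_mul p q).trans (add_le_add hp hq)

theorem totalDegree_add_le {p q : MvPolynomial σ ℝ} {k : ℕ} (hp : p.totalDegree ≤ k)
    (hq : q.totalDegree ≤ k) : (p + q).totalDegree ≤ k :=
  (totalDegree_add p q).trans (max_le hp hq)

theorem totalDegree_sub_le {p q : MvPolynomial σ ℝ} {k : ℕ} (hp : p.totalDegree ≤ k)
    (hq : q.totalDegree ≤ k) : (p - q).totalDegree ≤ k :=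
  (totalDegree_sub p q).trans (max_le hp hq)

theorem totalDegree_sq_le {p : MvPolynomial σ ℝ} {k : ℕ} (hp : p.totalDegree ≤ k) :
    (p ^ 2).totalDegree ≤ k + k := by
  rw [sq]; exact totalDegree_mul_le hp hp

/-- The Cauchy–Schwarz inequality for pseudo-expectations. -/
theorem IsPseudoExpectation.cauchySchwarz (hE : IsPseudoExpectation 96 E)
    {u v : MvPolynomial σ ℝ} (hu : u.totalDegree ≤ 48) (hv : v.totalDegree ≤ 48) :
    E (u * v) ^ 2 ≤ E (u ^ 2) * E (v ^ 2) := by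
  have key : ∀ t : ℝ, 0 ≤ E (v ^ 2) * (t * t) + 2 * E (u * v) * t + E (u ^ 2) := by
    intro t
    have h := hE.nonneg_sq (p := u + t • v)
      (totalDegree_add_le hu ((totalDegree_smul_le t v).trans hv))
    have e : (u + t • v) ^ 2 = u ^ 2 + (2 * t) • (u * v) + (t * t) • v ^ 2 := by
      simp only [smul_eq_C_mul, C_mul]
      rw [show (C 2 : MvPolynomial σ ℝ) = 2 from map_ofNat C 2]
      ring
    rw [e, map_add, map_add, map_smul, map_smul, smul_eq_mul, smul_eq_mul] at h
    linarith
  have := discrim_le_zero key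
  unfold discrim at this
  nlinarith

theorem OpBound.mono {k l : ℕ} {b c : ℝ} {f : MvPolynomial σ ℝ}
    (hE : IsPseudoExpectation 96 E) (h : OpBound E k b f) (hkl : k ≤ l)
    (hbc : b ≤ c) : OpBound E l c f where
  nonneg := h.nonneg.trans hbc
  degree := h.degree.trans hkl
  bound p hp := (h.bound p (by omega)).trans
    (mul_le_mul_of_nonneg_right (pow_le_pow_left₀ h.nonneg hbc 2) (hE.nonneg_sq (by omega)))

/-- The bound for `g` is used at the test polynomial `p * f`, which is why the degree budgets add.
-/
theorem OpBound.mul {k l : ℕ} {b c : ℝ} {f g : MvPolynomial σ ℝ}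
    (hf : OpBound E k b f) (hg : OpBound E l c g) : OpBound E (k + l) (b * c) (f * g) where
  nonneg := mul_nonneg hf.nonneg hg.nonneg
  degree := totalDegree_mul_le hf.degree hg.degree
  bound p hp := by
    have h1 := hg.bound (p * f) (by have := totalDegree_mul_le le_rfl hf.degree (p := p); omega)
    have h2 := hf.bound p (by omega)
    calc E (p ^ 2 * (f * g) ^ 2) = E ((p * f) ^ 2 * g ^ 2) := by ring_nf
      _ ≤ c ^ 2 * E ((p * f) ^ 2) := h1
      _ = c ^ 2 * E (p ^ 2 * f ^ 2) := by ring_nf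
      _ ≤ c ^ 2 * (b ^ 2 * E (p ^ 2)) := mul_le_mul_of_nonneg_left h2 (sq_nonneg c)
      _ = (b * c) ^ 2 * E (p ^ 2) := by ring

/-- The triangle inequality for the seminorm, applied to `p * f` and `p * g`; Cauchy–Schwarz
controls the cross term. -/
theorem OpBound.add {k : ℕ} {b c : ℝ} {f g : MvPolynomial σ ℝ} (hE : IsPseudoExpectation 96 E)
    (hf : OpBound E k b f) (hg : OpBound E k c g) : OpBound E k (b + c) (f + g) where
  nonneg := add_nonneg hf.nonneg hg.nonneg
  degree := totalDegree_add_le hf.degree hg.degree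
  bound p hp := by
    have hpf : (p * f).totalDegree ≤ 48 := (totalDegree_mul_le le_rfl hf.degree).trans hp
    have hpg : (p * g).totalDegree ≤ 48 := (totalDegree_mul_le le_rfl hg.degree).trans hp
    have h1 := hf.bound p hp
    have h2 := hg.bound p hp
    have hX : 0 ≤ E (p ^ 2) := hE.nonneg_sq (by omega)
    have h3 := hE.cauchySchwarz hpf hpg
    have h4 := hE.nonneg_sq hpf
    have h5 := hE.nonneg_sq hpg
    rw [mul_pow p f] at h3 h4
    rw [mul_pow p g] at h3 h5
    have h6 : E (p * f * (p * g)) ≤ b * c * E (p ^ 2) := by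
      refine le_of_abs_le (abs_le_of_sq_le_sq ?_
        (mul_nonneg (mul_nonneg hf.nonneg hg.nonneg) hX))
      calc E (p * f * (p * g)) ^ 2 ≤ E (p ^ 2 * f ^ 2) * E (p ^ 2 * g ^ 2) := h3
        _ ≤ (b ^ 2 * E (p ^ 2)) * (c ^ 2 * E (p ^ 2)) :=
          mul_le_mul h1 h2 h5 (mul_nonneg (sq_nonneg b) hX)
        _ = (b * c * E (p ^ 2)) ^ 2 := by ring
    have e : p ^ 2 * (f + g) ^ 2 = p ^ 2 * f ^ 2 + (2 : ℝ) • (p * f * (p * g)) + p ^ 2 * g ^ 2 := by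
      rw [smul_eq_C_mul, show (C 2 : MvPolynomial σ ℝ) = 2 from map_ofNat C 2]
      ring
    rw [e, map_add, map_add, map_smul, smul_eq_mul]
    linarith

theorem OpBound.const (hE : IsPseudoExpectation 96 E) {a b : ℝ} (h : |a| ≤ b) (k : ℕ) :
    OpBound E k b (C a) where
  nonneg := (abs_nonneg a).trans h
  degree := by simp
  bound p hp := by
    have e : p ^ 2 * (C a) ^ 2 = (a ^ 2) • p ^ 2 := by
      rw [smul_eq_C_mul, C_pow]; ring
    rw [e, map_smul, smul_eq_mul]
    apply mul_le_mul_of_nonneg_right _ (hE.nonneg_sq (by omega))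
    rw [← sq_abs a]
    exact pow_le_pow_left₀ (abs_nonneg a) h 2

theorem OpBound.sum (hE : IsPseudoExpectation 96 E) {ι : Type*} (s : Finset ι) {k : ℕ} {b : ℝ}
    {f : ι → MvPolynomial σ ℝ} (h : ∀ i ∈ s, OpBound E k b (f i)) :
    OpBound E k (s.card * b) (∑ i ∈ s, f i) := by
  classical
  induction s using Finset.induction_on with
  | empty => simpa using OpBound.const hE (a := 0) (b := 0) (by simp) k
  | insert a s ha ih =>
    rw [Finset.sum_insert ha, Finset.card_insert_of_notMem ha]
    have := (h a (by simp)).add hE (ih fun i hi => h i (by simp [hi]))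
    convert this using 1
    push_cast
    ring

/-- Cauchy–Schwarz for `p` and `p * f`. This turns operator bounds into bounds on values of `E`. -/
theorem OpBound.abs_le (hE : IsPseudoExpectation 96 E) {k : ℕ} {b : ℝ} {f p : MvPolynomial σ ℝ}
    (h : OpBound E k b f) (hp : p.totalDegree + k ≤ 48) : |E (p ^ 2 * f)| ≤ b * E (p ^ 2) := by
  have hX : 0 ≤ E (p ^ 2) := hE.nonneg_sq (by omega)
  apply abs_le_of_sq_le_sq _ (mul_nonneg h.nonneg hX)
  have h1 := hE.cauchySchwarz (u := p) (v := p * f) (by omega)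
    ((totalDegree_mul_le le_rfl h.degree).trans hp)
  rw [mul_pow] at h1
  calc E (p ^ 2 * f) ^ 2 = E (p * (p * f)) ^ 2 := by ring_nf
    _ ≤ _ := h1
    _ ≤ E (p ^ 2) * (b ^ 2 * E (p ^ 2)) := mul_le_mul_of_nonneg_left (h.bound p hp) hX
    _ = _ := by ring

end OperatorBounds

/-! ### Bounds up to powers of a parameter -/

section BigO

variable {σ : Type}

/-- `E` is a degree-`96` pseudo-expectation and `4 ≤ K`. -/
structure Scale (E : MvPolynomial σ ℝ →ₗ[ℝ] ℝ) (K : ℝ) : Prop where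
  pseudo : IsPseudoExpectation 96 E
  four_le : 4 ≤ K

/-- Multiplication by `f`, of degree at most `k`, is bounded by `K ^ n * δ`. -/
def BigO (E : MvPolynomial σ ℝ →ₗ[ℝ] ℝ) (K δ : ℝ) (k n : ℕ) (f : MvPolynomial σ ℝ) : Prop :=
  OpBound E k (K ^ n * δ) f

variable {E : MvPolynomial σ ℝ →ₗ[ℝ] ℝ} {K δ : ℝ} {k l m n : ℕ} {f g : MvPolynomial σ ℝ}

theorem Scale.one_le (hs : Scale E K) : 1 ≤ K := by linarith [hs.four_le]

theorem Scale.pos (hs : Scale E K) : 0 < K := by linarith [hs.four_le]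

theorem BigO.nonneg (hs : Scale E K) (hf : BigO E K δ k n f) : 0 ≤ δ :=
  nonneg_of_mul_nonneg_right (OpBound.nonneg hf) (pow_pos hs.pos n)

theorem BigO.le (hs : Scale E K) (hf : BigO E K δ k n f) (hk : k ≤ l) (hn : n ≤ m) :
    BigO E K δ l m f :=
  OpBound.mono hs.pseudo hf hk
    (mul_le_mul_of_nonneg_right (pow_le_pow_right₀ hs.one_le hn) (hf.nonneg hs))

theorem BigO.weaken (hs : Scale E K) {ε : ℝ} (hf : BigO E K δ k n f) (h : δ ≤ ε) :
    BigO E K ε k n f :=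
  OpBound.mono hs.pseudo hf le_rfl (mul_le_mul_of_nonneg_left h (pow_pos hs.pos n).le)

theorem BigO.congr (hf : BigO E K δ k n f) (h : f = g) : BigO E K δ k n g := h ▸ hf

/-- The extra power of `K` absorbs the factor 2, so numerical constants never need to be tracked. -/
theorem BigO.add (hs : Scale E K) (hf : BigO E K δ k n f) (hg : BigO E K δ l m g) :
    BigO E K δ (max k l) (max n m + 1) (f + g) := by
  have h := OpBound.add hs.pseudo (hf.le hs (le_max_left k l) (le_max_left n m))
    (hg.le hs (le_max_right k l) (le_max_right n m))
  refine h.mono hs.pseudo le_rfl ?_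
  have h1 : 0 ≤ K ^ max n m * δ := mul_nonneg (pow_pos hs.pos _).le (hf.nonneg hs)
  rw [pow_succ]
  nlinarith [hs.four_le]

theorem BigO.mul (hf : BigO E K δ k n f) (hg : BigO E K 1 l m g) :
    BigO E K δ (k + l) (n + m) (f * g) := by
  have h := OpBound.mul hf hg
  unfold BigO
  convert h using 1
  ring

theorem BigO.mul_left (hf : BigO E K 1 k n f) (hg : BigO E K δ l m g) :
    BigO E K δ (k + l) (n + m) (f * g) := by
  have h := OpBound.mul hf hg
  unfold BigO
  convert h using 1
  ring

theorem BigO.const (hs : Scale E K) {a : ℝ} (h : |a| ≤ K ^ n) : BigO E K 1 0 n (C a) :=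
  OpBound.const hs.pseudo (by simpa using h) 0

theorem BigO.two (hs : Scale E K) : BigO E K 1 0 1 (2 : MvPolynomial σ ℝ) :=
  (BigO.const hs (a := 2) (by rw [abs_two, pow_one]; linarith [hs.four_le])).congr (map_ofNat C 2)

theorem BigO.zero (hs : Scale E K) (hδ : 0 ≤ δ) : BigO E K δ 0 0 (0 : MvPolynomial σ ℝ) := by
  have h := OpBound.const (σ := σ) hs.pseudo (a := 0) (b := K ^ 0 * δ) (by simpa using hδ) 0
  rwa [C_0] at h

theorem BigO.neg (hs : Scale E K) (hf : BigO E K δ k n f) : BigO E K δ k n (-f) := by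
  have h := (BigO.const (n := 0) hs (a := -1) (by simp)).mul_left hf
  rw [zero_add, zero_add] at h
  exact h.congr (by simp)

theorem BigO.sub (hs : Scale E K) (hf : BigO E K δ k n f) (hg : BigO E K δ l m g) :
    BigO E K δ (max k l) (max n m + 1) (f - g) :=
  (hf.add hs (hg.neg hs)).congr (sub_eq_add_neg f g).symm

/-- The difference of two products with close factors. -/
theorem BigO.mul_sub_mul (hs : Scale E K) {f' g' : MvPolynomial σ ℝ} {k' l' n' m' : ℕ}
    (hf : BigO E K δ k n (f - f')) (hg : BigO E K δ l m (g - g'))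
    (hf' : BigO E K 1 k' n' f') (hg' : BigO E K 1 l' m' g) :
    BigO E K δ (max (k + l') (k' + l)) (max (n + m') (n' + m) + 1) (f * g - f' * g') :=
  ((hf.mul hg').add hs (hf'.mul_left hg)).congr (by ring)

theorem BigO.sum (hs : Scale E K) {ι : Type*} (s : Finset ι) (hι : (s.card : ℝ) ≤ K) (hδ : 0 ≤ δ)
    {f : ι → MvPolynomial σ ℝ} (h : ∀ i ∈ s, BigO E K δ k n (f i)) :
    BigO E K δ k (n + 1) (∑ i ∈ s, f i) := by
  have h0 : 0 ≤ K ^ n * δ := mul_nonneg (pow_pos hs.pos n).le hδ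
  refine (OpBound.sum hs.pseudo s h).mono hs.pseudo le_rfl ?_
  rw [pow_succ]
  nlinarith

theorem BigO.sum_sub_sum (hs : Scale E K) {ι : Type*} (s : Finset ι) (hι : (s.card : ℝ) ≤ K)
    (hδ : 0 ≤ δ) {f g : ι → MvPolynomial σ ℝ} (h : ∀ i ∈ s, BigO E K δ k n (f i - g i)) :
    BigO E K δ k (n + 1) (∑ i ∈ s, f i - ∑ i ∈ s, g i) := by
  rw [← Finset.sum_sub_distrib]
  exact BigO.sum hs s hι hδ h

theorem BigO.abs_le (hs : Scale E K) {p : MvPolynomial σ ℝ} (hf : BigO E K δ k n f)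
    (hp : p.totalDegree + k ≤ 48) : |E (p ^ 2 * f)| ≤ K ^ n * δ * E (p ^ 2) :=
  OpBound.abs_le hs.pseudo hf hp

/-- Dividing by a scalar that is bounded below by `1 / K ^ m`. -/
theorem BigO.of_const_mul (hs : Scale E K) {a : ℝ} (ha : a ≠ 0) (ha' : |a⁻¹| ≤ K ^ m)
    (hf : BigO E K δ k n (C a * f)) : BigO E K δ k (m + n) f := by
  have h := (BigO.const hs ha').mul_left hf
  rw [zero_add] at h
  refine h.congr ?_
  rw [← mul_assoc, ← C_mul, inv_mul_cancel₀ ha, C_1, one_mul]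

/-- A bound on `E (p ^ 2 * f ^ 2)` by a square gives an operator bound by the root. -/
theorem BigO.of_sq (hs : Scale E K) {ε : ℝ} (hε : 0 ≤ ε) (hεδ : ε ^ 2 = δ)
    (hf : f.totalDegree ≤ k)
    (h : ∀ p : MvPolynomial σ ℝ, p.totalDegree + k ≤ 48 →
      E (p ^ 2 * f ^ 2) ≤ K ^ n * δ * E (p ^ 2)) : BigO E K ε k n f where
  nonneg := mul_nonneg (pow_pos hs.pos n).le hε
  degree := hf
  bound p hp := by
    refine (h p hp).trans (mul_le_mul_of_nonneg_right ?_ (hs.pseudo.nonneg_sq (by omega)))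
    rw [mul_pow, hεδ]
    refine mul_le_mul_of_nonneg_right ?_ (hεδ ▸ sq_nonneg ε)
    -- `K ^ n ≤ (K ^ n) ^ 2`, so the root is taken of `δ` only and the exponent `n` is kept.
    have := one_le_pow₀ hs.one_le (n := n)
    nlinarith

end BigO

/-! ### Well-conditioned matrices have bounded left inverses -/

section SingularValues

variable {V W : Type*} [NormedAddCommGroup V] [InnerProductSpace ℝ V] [FiniteDimensional ℝ V]
  [NormedAddCommGroup W] [InnerProductSpace ℝ W] [FiniteDimensional ℝ W]

/-- In an eigenbasis of `T* T`, `‖T x‖ ^ 2` is a combination of squared coordinates of `x` whose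
weights are the squared singular values. With indices starting at 0, the least of them is number `n
- 1`. -/
theorem singularValues_last_mul_norm_le (T : V →ₗ[ℝ] W) (n : ℕ)
    (hn : Module.finrank ℝ V = n) (x : V) : T.singularValues (n - 1) * ‖x‖ ≤ ‖T x‖ := by
  -- For `n = 0` the truncated index `n - 1` names no eigenvalue, but both sides vanish.
  rcases Nat.eq_zero_or_pos n with h0 | hpos
  · have : Subsingleton V := Module.finrank_zero_iff.mp (hn.trans h0)
    rw [Subsingleton.elim x 0]
    simp
  have hS := T.isSymmetric_adjoint_comp_self
  set b := hS.eigenvectorBasis hn with hb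
  have hsq : (T.singularValues (n - 1) * ‖x‖) ^ 2 ≤ ‖T x‖ ^ 2 := by
    have h1 : ‖T x‖ ^ 2 = ∑ i, hS.eigenvalues hn i * (inner ℝ (b i) x) ^ 2 := by
      rw [← real_inner_self_eq_norm_sq, ← LinearMap.adjoint_inner_left,
        ← LinearMap.comp_apply, ← b.sum_inner_mul_inner]
      refine Finset.sum_congr rfl fun i _ => ?_
      rw [hS x (b i), hb, hS.apply_eigenvectorBasis hn i, inner_smul_right,
        real_inner_comm]
      simp only [RCLike.ofReal_real_eq_id, id]
      ring
    have h2 : ‖x‖ ^ 2 = ∑ i, (inner ℝ (b i) x) ^ 2 := by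
      rw [← real_inner_self_eq_norm_sq, ← b.sum_inner_mul_inner]
      refine Finset.sum_congr rfl fun i _ => ?_
      rw [real_inner_comm]
      ring
    rw [mul_pow, h1, h2, Finset.mul_sum]
    refine Finset.sum_le_sum fun i _ => mul_le_mul_of_nonneg_right ?_ (sq_nonneg _)
    rw [← T.sq_singularValues_fin hn i]
    exact pow_le_pow_left₀ (T.singularValues_nonneg _)
      (T.singularValues_antitone (by have := i.2; omega)) 2
  exact le_of_abs_le (abs_le_of_sq_le_sq hsq (norm_nonneg _))

/-- The witness is the Moore–Penrose inverse `(T* T)⁻¹ T*`: `T` composed with it is an orthogonal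
projection, so it does not increase norms. -/
theorem exists_leftInverse_of_norm_le (T : V →ₗ[ℝ] W) {κ : ℝ} (hκ : 0 < κ)
    (hT : ∀ x, κ * ‖x‖ ≤ ‖T x‖) :
    ∃ L : W →ₗ[ℝ] V, (∀ x, L (T x) = x) ∧ ∀ y, κ * ‖L y‖ ≤ ‖y‖ := by
  have hTinj : ∀ x, T x = 0 → x = 0 := fun x hx => by
    have h := hT x
    rw [hx, norm_zero] at h
    exact norm_le_zero_iff.mp (by nlinarith)
  set S : V →ₗ[ℝ] V := T.adjoint ∘ₗ T with hS
  have hSinj : Function.Injective S := by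
    refine (injective_iff_map_eq_zero S).mpr fun x hx => hTinj x ?_
    have h : inner ℝ (T x) (T x) = 0 := by
      rw [← LinearMap.adjoint_inner_left, ← LinearMap.comp_apply, ← hS, hx, inner_zero_left]
    exact inner_self_eq_zero.mp h
  set e := LinearEquiv.ofInjectiveEndo S hSinj with he
  have hSe : ∀ z, S (e.symm z) = z := fun z => e.apply_symm_apply z
  refine ⟨e.symm.toLinearMap ∘ₗ T.adjoint, fun x => ?_, fun y => ?_⟩
  · exact e.symm_apply_apply x
  · set x := e.symm (T.adjoint y) with hx
    change κ * ‖x‖ ≤ ‖y‖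
    have h1 : ‖T x‖ * ‖T x‖ ≤ ‖y‖ * ‖T x‖ := by
      rw [← real_inner_self_eq_norm_mul_norm, ← LinearMap.adjoint_inner_left,
        ← LinearMap.comp_apply, ← hS, hx, hSe, LinearMap.adjoint_inner_left]
      exact real_inner_le_norm _ _
    rcases (norm_nonneg (T x)).eq_or_lt with h0 | h0
    · exact (hT x).trans (h0 ▸ norm_nonneg y)
    · exact (hT x).trans (le_of_mul_le_mul_right h1 h0)

end SingularValues

/-! ### Symmetric units as bounded combinations of the ground truth. -/

theorem card_upperPairs (r : ℕ) : Fintype.card (UpperPairs r) = (r + 1).choose 2 := by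
  rw [← Fintype.card_congr (Sym2.sortEquiv (α := Fin r)), Sym2.card, Fintype.card_fin]

/-- The index pair `(min i j, max i j)`. -/
def toUpper {r : ℕ} (i j : Fin r) : UpperPairs r := ⟨(min i j, max i j), min_le_max⟩

theorem toUpper_comm {r : ℕ} (i j : Fin r) : toUpper i j = toUpper j i := by
  simp [toUpper, min_comm, max_comm]

theorem toUpper_eq_iff {r : ℕ} (i j k l : Fin r) :
    toUpper i j = toUpper k l ↔ (i = k ∧ j = l) ∨ (i = l ∧ j = k) := by
  simp only [toUpper, Subtype.mk.injEq, Prod.mk.injEq]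
  constructor
  · rintro ⟨h1, h2⟩
    rcases le_total i j with h | h <;> rcases le_total k l with h' | h' <;>
      simp_all
  · rintro (⟨rfl, rfl⟩ | ⟨rfl, rfl⟩)
    · simp
    · simp [min_comm, max_comm]

/-- The symmetric matrix unit `(e_i e_jᵀ + e_j e_iᵀ) / 2`. -/
def symmUnit {r : ℕ} (i j : Fin r) : Matrix (Fin r) (Fin r) ℝ :=
  (1 / 2 : ℝ) • (Matrix.single i j 1 + Matrix.single j i 1)

/-- The coefficients are the rows of a bounded left inverse of the matrix of upper triangular
entries. -/
theorem exists_dual_coefficients {d r : ℕ} {Qs : Fin d → Matrix (Fin r) (Fin r) ℝ} {β κ : ℝ}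
    (hκ : 0 < κ) (hsymm : ∀ a, (Qs a).IsSymm) (h : RingAssumption Qs β κ) :
    ∃ c : Fin r → Fin r → Fin d → ℝ, (∀ i j, c i j = c j i) ∧ (∀ i j a, |c i j a| ≤ 1 / κ) ∧
      ∀ i j, ∑ a, c i j a • Qs a = symmUnit i j := by
  set T := Matrix.toEuclideanLin (upperMatrix Qs) with hT
  have hn : Module.finrank ℝ (EuclideanSpace ℝ (UpperPairs r)) = (r + 1).choose 2 := by
    rw [finrank_euclideanSpace, card_upperPairs]
  obtain ⟨L, hL, hLb⟩ := exists_leftInverse_of_norm_le T hκ fun x =>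
    (mul_le_mul_of_nonneg_right h.condition (norm_nonneg x)).trans
      (singularValues_last_mul_norm_le T _ hn x)
  have hentry : ∀ p a, |L (EuclideanSpace.single a 1) p| ≤ 1 / κ := fun p a => by
    have h1 := hLb (EuclideanSpace.single a 1)
    have h2 := PiLp.norm_apply_le (L (EuclideanSpace.single a 1)) p
    rw [Real.norm_eq_abs] at h2
    rw [PiLp.norm_single, norm_one] at h1
    rw [le_div_iff₀ hκ]
    nlinarith
  have hinv : ∀ p q : UpperPairs r,
      ∑ a, L (EuclideanSpace.single a 1) p * upperMatrix Qs a q = if p = q then 1 else 0 := by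
    intro p q
    have h1 : T (EuclideanSpace.single q 1) =
        ∑ a, upperMatrix Qs a q • EuclideanSpace.single a (1 : ℝ) := by
      ext a
      simp [hT, Matrix.toLpLin_apply, Matrix.mulVec_single, Pi.single_apply]
    have h2 := congrArg (fun v => v p) (hL (EuclideanSpace.single q 1))
    simp only [h1, map_sum, map_smul] at h2
    simpa [mul_comm, Pi.single_apply] using h2
  -- For `i ≠ j` the row of the left inverse yields `e_i e_jᵀ + e_j e_iᵀ`, which is twice `symmUnit
  -- i j`.
  refine ⟨fun i j a => (if i = j then 1 else 1 / 2) * L (EuclideanSpace.single a 1) (toUpper i j),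
    ?_, ?_, ?_⟩
  · intro i j
    ext a
    simp only [toUpper_comm i j, eq_comm (a := i) (b := j)]
  · intro i j a
    rw [abs_mul]
    have h1 := hentry (toUpper i j) a
    have h2 : |(if i = j then (1 : ℝ) else 1 / 2)| ≤ 1 := by split_ifs <;> norm_num [abs_le]
    exact (mul_le_of_le_one_left (abs_nonneg _) h2).trans h1
  · intro i j
    ext k l
    have h1 := hinv (toUpper i j) (toUpper k l)
    have h2 : ∀ a, upperMatrix Qs a (toUpper k l) = Qs a k l := by
      intro a
      rcases le_total k l with hkl | hkl
      · simp [upperMatrix, toUpper, hkl]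
      · simpa [upperMatrix, toUpper, hkl] using (hsymm a).apply k l
    simp only [h2, toUpper_eq_iff] at h1
    simp only [Matrix.sum_apply, Matrix.smul_apply, smul_eq_mul, mul_assoc, ← Finset.mul_sum, h1]
    simp only [symmUnit, Matrix.smul_apply, Matrix.add_apply, Matrix.single_apply, smul_eq_mul]
    by_cases hij : i = j
    · subst hij
      by_cases hk : i = k <;> by_cases hl : i = l <;> simp [hk, hl] <;> split_ifs <;> norm_num
    · by_cases h3 : i = k ∧ j = l
      · obtain ⟨rfl, rfl⟩ := h3
        simp [hij, Ne.symm hij]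
      · by_cases h4 : i = l ∧ j = k
        · obtain ⟨rfl, rfl⟩ := h4
          simp [hij, Ne.symm hij]
        · have h5 : ¬ (j = k ∧ i = l) := fun h => h4 h.symm
          simp [hij, h3, h4, h5]

/-! ### Consequences of non-degeneracy for the normalized ground truth -/

section Gauge

variable {d r : ℕ} {Qs : Fin d → Matrix (Fin r) (Fin r) ℝ} {lam mu : EuclideanSpace ℝ (Fin d)}
  {υ : ℝ}

/-- An orthogonal matrix that intertwines two diagonal matrices, one with distinct entries, is a
signed permutation matrix. -/
theorem exists_signedPerm {V : Matrix (Fin r) (Fin r) ℝ} (hV : V ∈ Matrix.orthogonalGroup (Fin r) ℝ)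
    {D ev : Fin r → ℝ} (hev : Function.Injective ev)
    (h : ∀ i j, V i j * D j = ev i * V i j) :
    ∃ π : Fin r → Fin r, Function.Injective π ∧ (∀ j, D j = ev (π j)) ∧
      (∀ i j, j ≠ i → V (π i) j = 0) ∧ ∀ i, |V (π i) i| = 1 := by
  have horth : ∀ i j, ∑ k, V k i * V k j = if i = j then 1 else 0 := fun i j => by
    have := congrFun (congrFun (Matrix.mem_orthogonalGroup_iff' _ _ |>.mp hV) i) j
    simpa [Matrix.mul_apply, Matrix.star_eq_conjTranspose, Matrix.one_apply] using this
  have hex : ∀ j, ∃ i, V i j ≠ 0 := fun j => by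
    by_contra! hj
    have := horth j j
    simp [hj] at this
  choose π hπ using hex
  have hD : ∀ j, D j = ev (π j) := fun j => by
    have := h (π j) j
    rw [mul_comm] at this
    exact mul_right_cancel₀ (hπ j) this
  -- A nonzero entry forces `ev i = D j`; as the `ev i` are distinct, each column has one nonzero
  -- entry.
  have hsupp : ∀ i j, V i j ≠ 0 → i = π j := fun i j hij => by
    have := h i j
    rw [mul_comm] at this
    exact hev ((mul_right_cancel₀ hij this).symm.trans (hD j))
  have hcol : ∀ i j, ∑ k, V k i * V k j = V (π i) i * V (π i) j := fun i j =>
    Finset.sum_eq_single_of_mem _ (Finset.mem_univ _) fun k _ hk => by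
      have : V k i = 0 := by
        by_contra hne
        exact hk (hsupp k i hne)
      rw [this, zero_mul]
  have hinj : Function.Injective π := fun i j hij => by
    by_contra hne
    have h1 := (hcol i j).symm.trans (horth i j)
    rw [if_neg hne] at h1
    rcases mul_eq_zero.mp h1 with h1 | h1
    · exact hπ i h1
    · exact hπ j (hij ▸ h1)
  refine ⟨π, hinj, hD, fun i j hji => ?_, fun i => ?_⟩
  · by_contra hne
    exact hji (hinj (hsupp _ _ hne).symm)
  · have h1 := (hcol i i).symm.trans (horth i i)
    rw [if_pos rfl, ← sq] at h1
    exact (pow_eq_one_iff_of_nonneg (abs_nonneg _) two_ne_zero).mp ((sq_abs _).trans h1)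

/-- The diagonalizing `V` intertwines two diagonal matrices, hence is a signed permutation. It
merely permutes the eigenvalues, and permutes and flips signs of the entries of `Q_mu`, so the
non-degeneracy bounds hold in the normalized coordinates; sorting removes the absolute value from
the gaps. -/
theorem gauge_gaps (hυ : 0 < υ) (hnd : NonDegenerate υ lam mu Qs) (hg : GaugeFixed lam mu Qs) :
    (∀ i j, i < j → υ ≤ combo lam Qs j j - combo lam Qs i i) ∧
      ∀ i j, υ ≤ |combo mu Qs i j| := by
  obtain ⟨V, hV, ev, hlam, hgap, hmu⟩ := hnd
  have hev : Function.Injective ev := fun i j hij => by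
    by_contra hne
    have := hgap i j hne
    rw [hij, sub_self, abs_zero] at this
    linarith
  have hVV : V * V.transpose = 1 := by
    simpa [Matrix.star_eq_conjTranspose] using (Matrix.mem_orthogonalGroup_iff _ _).mp hV
  have hdiag : combo lam Qs = Matrix.diagonal fun j => combo lam Qs j j := by
    ext i j
    by_cases hij : i = j
    · subst hij; simp
    · simp [hij, hg.diag i j hij]
  have hinter : V * combo lam Qs = Matrix.diagonal ev * V := by
    rw [hlam, ← mul_assoc, ← mul_assoc, hVV, one_mul]
  obtain ⟨π, hinj, hD, hzero, hone⟩ := exists_signedPerm hV (D := fun j => combo lam Qs j j) hev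
    fun i j => by
      have := congrFun (congrFun hinter i) j
      rw [hdiag] at this
      simpa [Matrix.mul_diagonal, Matrix.diagonal_mul] using this
  refine ⟨fun i j hij => ?_, fun i j => ?_⟩
  · have h1 := hgap (π j) (π i) (hinj.ne hij.ne')
    rw [← hD, ← hD, abs_of_nonneg (sub_nonneg.mpr (hg.sorted i j hij))] at h1
    exact h1
  · have h1 := hmu (π i) (π j)
    have h2 : (V * combo mu Qs * V.transpose) (π i) (π j) =
        V (π i) i * combo mu Qs i j * V (π j) j := by
      simp only [Matrix.mul_apply, Matrix.transpose_apply]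
      rw [Finset.sum_eq_single_of_mem j (Finset.mem_univ _),
        Finset.sum_eq_single_of_mem i (Finset.mem_univ _)]
      · intro k _ hk
        rw [hzero i k hk, zero_mul]
      · intro k _ hk
        rw [hzero j k hk, mul_zero]
    rwa [h2, abs_mul, abs_mul, hone, hone, one_mul, mul_one] at h1

end Gauge

/-! ### Approximate solutions and the approximate Jordan homomorphism -/

/-- The matrix of polynomials `∑ a, u a • Y a`. -/
def polyCombo {σ : Type} {d r : ℕ} (Y : Fin d → Matrix (Fin r) (Fin r) (MvPolynomial σ ℝ))
    (u : Fin d → ℝ) : Matrix (Fin r) (Fin r) (MvPolynomial σ ℝ) :=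
  ∑ a, (C (u a) : MvPolynomial σ ℝ) • Y a

/-- The matrices of polynomials `Y a` have, up to errors of size `η`, the second and third moments
of `Qs a`, and their upper triangular parts have the bounded left inverse `L`. -/
structure ApproxSolution {σ : Type} {d r : ℕ} (E : MvPolynomial σ ℝ →ₗ[ℝ] ℝ) (K η : ℝ)
    (Qs : Fin d → Matrix (Fin r) (Fin r) ℝ)
    (Y : Fin d → Matrix (Fin r) (Fin r) (MvPolynomial σ ℝ))
    (L : UpperPairs r → Fin d → MvPolynomial σ ℝ) : Prop where
  scale : Scale E K
  card_d : (d : ℝ) ≤ K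
  card_r : (r : ℝ) ≤ K
  eta_nonneg : 0 ≤ η
  symm : ∀ a i j, Y a i j = Y a j i
  bounded : ∀ a i j, BigO E K 1 1 1 (Y a i j)
  bounded_left : ∀ p a, BigO E K 1 1 2 (L p a)
  left_inv : ∀ i j k l, BigO E K η 2 2 (∑ a, L (toUpper i j) a * Y a k l -
    C (if (i = k ∧ j = l) ∨ (i = l ∧ j = k) then 1 else 0))
  second : ∀ a b, BigO E K η 2 5 ((Y a * Y b).trace - C (Qs a * Qs b).trace)
  third : ∀ a b c, BigO E K η 3 8 ((Y a * Y b * Y c).trace - C (Qs a * Qs b * Qs c).trace)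

theorem trace_sum_mul {A : Type*} [CommRing A] {d r : ℕ} (Y : Fin d → Matrix (Fin r) (Fin r) A)
    (u : Fin d → A) (Z : Matrix (Fin r) (Fin r) A) :
    ((∑ a, u a • Y a) * Z).trace = ∑ a, u a * (Y a * Z).trace := by
  simp [Finset.sum_mul, Matrix.trace_sum]

theorem trace_sum_mul_sum_mul {A : Type*} [CommRing A] {d r : ℕ}
    (Y : Fin d → Matrix (Fin r) (Fin r) A) (u v : Fin d → A) (Z : Matrix (Fin r) (Fin r) A) :
    ((∑ a, u a • Y a) * (∑ a, v a • Y a) * Z).trace =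
      ∑ a, u a * ∑ b, v b * (Y a * Y b * Z).trace := by
  simp only [Finset.sum_mul, Finset.mul_sum, Matrix.trace_sum, Matrix.smul_mul, Matrix.mul_smul,
    Matrix.trace_smul, smul_eq_mul]
  rw [Finset.sum_comm]
  exact Finset.sum_congr rfl fun a _ => Finset.sum_congr rfl fun b _ => by ring

section Jordan

variable {σ : Type} {d r : ℕ} {E : MvPolynomial σ ℝ →ₗ[ℝ] ℝ} {K η : ℝ}
  {Qs : Fin d → Matrix (Fin r) (Fin r) ℝ}
  {Y : Fin d → Matrix (Fin r) (Fin r) (MvPolynomial σ ℝ)}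
  {L : UpperPairs r → Fin d → MvPolynomial σ ℝ}

theorem polyCombo_apply (u : Fin d → ℝ) (i j : Fin r) :
    polyCombo Y u i j = ∑ a, C (u a) * Y a i j := by
  simp [polyCombo, Matrix.sum_apply]

namespace ApproxSolution

theorem sum_d (hY : ApproxSolution E K η Qs Y L) {δ : ℝ} (hδ : 0 ≤ δ) {k n : ℕ}
    {f : Fin d → MvPolynomial σ ℝ} (h : ∀ a, BigO E K δ k n (f a)) :
    BigO E K δ k (n + 1) (∑ a, f a) :=
  BigO.sum hY.scale _ (by simpa using hY.card_d) hδ fun a _ => h a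

theorem sum_r (hY : ApproxSolution E K η Qs Y L) {δ : ℝ} (hδ : 0 ≤ δ) {k n : ℕ}
    {f : Fin r → MvPolynomial σ ℝ} (h : ∀ a, BigO E K δ k n (f a)) :
    BigO E K δ k (n + 1) (∑ a, f a) :=
  BigO.sum hY.scale _ (by simpa using hY.card_r) hδ fun a _ => h a

theorem polyCombo_symm (hY : ApproxSolution E K η Qs Y L) (u : Fin d → ℝ) (i j : Fin r) :
    polyCombo Y u i j = polyCombo Y u j i := by
  simp only [polyCombo_apply, hY.symm _ i j]

/-- `K ^ 6` is a common ceiling for all coefficient vectors that occur; the largest bound needed is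
`K ^ 5`, in `GaugedSolution.expansion`. -/
theorem polyCombo_bounded (hY : ApproxSolution E K η Qs Y L) {u : Fin d → ℝ}
    (hu : ∀ a, |u a| ≤ K ^ 6) (i j : Fin r) : BigO E K 1 1 8 (polyCombo Y u i j) := by
  rw [polyCombo_apply]
  exact hY.sum_d zero_le_one fun a => (BigO.const hY.scale (hu a)).mul (hY.bounded a i j)

theorem trace_polyCombo_mul (hY : ApproxSolution E K η Qs Y L) {w : Fin d → ℝ}
    (hw : ∀ a, |w a| ≤ K ^ 6) (b : Fin d) :
    BigO E K η 2 12 ((polyCombo Y w * Y b).trace - C ((∑ a, w a • Qs a) * Qs b).trace) := by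
  rw [polyCombo, trace_sum_mul, trace_sum_mul, map_sum, ← Finset.sum_sub_distrib]
  refine hY.sum_d hY.eta_nonneg fun a => ?_
  exact ((BigO.const hY.scale (hw a)).mul_left (hY.second a b)).congr (by rw [C_mul]; ring)

theorem trace_polyCombo_mul_mul (hY : ApproxSolution E K η Qs Y L) {u v : Fin d → ℝ}
    (hu : ∀ a, |u a| ≤ K ^ 6) (hv : ∀ a, |v a| ≤ K ^ 6) (b : Fin d) :
    BigO E K η 3 22 ((polyCombo Y u * polyCombo Y v * Y b).trace -
      C ((∑ a, u a • Qs a) * (∑ a, v a • Qs a) * Qs b).trace) := by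
  rw [polyCombo, polyCombo, trace_sum_mul_sum_mul, trace_sum_mul_sum_mul, map_sum,
    ← Finset.sum_sub_distrib]
  refine hY.sum_d hY.eta_nonneg fun a => ?_
  have h : BigO E K η 3 15 (∑ c, C (v c) * (Y a * Y c * Y b).trace -
      C (∑ c, v c * (Qs a * Qs c * Qs b).trace)) := by
    rw [map_sum, ← Finset.sum_sub_distrib]
    refine hY.sum_d hY.eta_nonneg fun c => ?_
    exact ((BigO.const hY.scale (hv c)).mul_left (hY.third a c b)).congr (by rw [C_mul]; ring)
  exact ((BigO.const hY.scale (hu a)).mul_left h).congr (by rw [C_mul]; ring)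

/-- The positions `(k, l)` and `(l, k)` coincide on the diagonal and are distinct off it, whence the
factor 1 or 2. The algebra is general because both polynomial and real matrices are contracted in
this way. -/
theorem sum_mul_indicator {A : Type*} [CommRing A] [Algebra ℝ A] (X : Matrix (Fin r) (Fin r) A)
    (hX : ∀ i j, X i j = X j i) (k l : Fin r) :
    ∑ i, ∑ j, X i j * algebraMap ℝ A (if (k = j ∧ l = i) ∨ (k = i ∧ l = j) then 1 else 0) =
      algebraMap ℝ A (if k = l then 1 else 2) * X k l := by
  by_cases hkl : k = l
  · subst hkl
    rw [Finset.sum_eq_single_of_mem k (Finset.mem_univ _),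
      Finset.sum_eq_single_of_mem k (Finset.mem_univ _)]
    · simp
    · intro j _ hj
      simp [hj.symm]
    · intro i _ hi
      exact Finset.sum_eq_zero fun j _ => by simp [hi.symm]
  · have e : ∀ i j, X i j * algebraMap ℝ A (if (k = j ∧ l = i) ∨ (k = i ∧ l = j) then 1 else 0) =
        (if k = j then if l = i then X i j else 0 else 0) +
          (if l = j then if k = i then X i j else 0 else 0) := by
      intro i j
      by_cases h1 : k = j
      · have h2 : l ≠ j := fun h => hkl (h1.trans h.symm)
        simp [h1, h2]
      · simp only [h1, false_and, false_or, if_false, zero_add]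
        by_cases h2 : l = j <;> by_cases h3 : k = i <;> simp [h2, h3]
    simp only [e, Finset.sum_add_distrib, Finset.sum_ite_eq, Finset.mem_univ, if_true]
    rw [if_neg hkl, hX l k, map_ofNat]
    ring

/-- A symmetric matrix that is nearly orthogonal to all `Y a` nearly vanishes. -/
theorem small_of_trace_small (hY : ApproxSolution E K η Qs Y L) {k n m : ℕ}
    {X : Matrix (Fin r) (Fin r) (MvPolynomial σ ℝ)} (hX : ∀ i j, X i j = X j i)
    (hXb : ∀ i j, BigO E K 1 k n (X i j))
    (hXY : ∀ a, BigO E K η (k + 1) m ((X * Y a).trace)) (i j : Fin r) :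
    BigO E K η (k + 2) (max (m + 3) (n + 4) + 1) (X i j) := by
  have hs := hY.scale
  -- Weighting the traces by a row of `L` and exchanging sums turns the coefficient of `X s t` into
  -- `∑ a, L (toUpper i j) a * Y a t s`, nearly an indicator. What remains is `X i j`, counted once
  -- or twice.
  have h1 : BigO E K η (k + 2) (m + 3) (∑ a, L (toUpper i j) a * (X * Y a).trace) :=
    hY.sum_d hY.eta_nonneg fun a => ((hY.bounded_left _ a).mul_left (hXY a)).le hs
      (by omega) (by omega)
  have h2 : BigO E K η (k + 2) (n + 4) (∑ s, ∑ t, X s t * (∑ a, L (toUpper i j) a * Y a t s -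
      C (if (i = t ∧ j = s) ∨ (i = s ∧ j = t) then 1 else 0))) :=
    (hY.sum_r hY.eta_nonneg fun s => hY.sum_r hY.eta_nonneg fun t =>
      (hXb s t).mul_left (hY.left_inv i j t s)).le hs (by omega) (by omega)
  have h3 : BigO E K η (k + 2) (max (m + 3) (n + 4) + 1) (C (if i = j then 1 else 2) * X i j) := by
    refine ((h1.sub hs h2).congr ?_).le hs (by omega) le_rfl
    have e := sum_mul_indicator X hX i j
    rw [algebraMap_eq] at e
    rw [← e]
    simp only [Matrix.trace, Matrix.diag, Matrix.mul_apply, mul_sub, Finset.sum_sub_distrib,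
      Finset.mul_sum]
    rw [Finset.sum_comm, sub_eq_iff_eq_add, add_sub_cancel]
    refine Finset.sum_congr rfl fun s _ => ?_
    rw [Finset.sum_comm]
    exact Finset.sum_congr rfl fun t _ => Finset.sum_congr rfl fun a _ => by ring
  refine (BigO.of_const_mul (m := 0) hs ?_ ?_ h3).le hs le_rfl (by omega)
  · split_ifs <;> norm_num
  · split_ifs <;> norm_num [abs_le]

/-- The linear map that sends `Qs a` to `Y a` nearly preserves the Jordan product. -/
theorem jordan (hY : ApproxSolution E K η Qs Y L) {u v w : Fin d → ℝ}
    (hu : ∀ a, |u a| ≤ K ^ 6) (hv : ∀ a, |v a| ≤ K ^ 6) (hw : ∀ a, |w a| ≤ K ^ 6)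
    (h : (∑ a, u a • Qs a) * (∑ a, v a • Qs a) + (∑ a, v a • Qs a) * (∑ a, u a • Qs a) =
      (2 : ℝ) • ∑ a, w a • Qs a) (i j : Fin r) :
    BigO E K η 4 30 ((polyCombo Y u * polyCombo Y v + polyCombo Y v * polyCombo Y u) i j -
      2 * polyCombo Y w i j) := by
  have hs := hY.scale
  -- Traces against the symmetric `Y a` detect only the symmetric part of a matrix; this is why the
  -- Jordan product is used instead of the matrix product.
  set X : Matrix (Fin r) (Fin r) (MvPolynomial σ ℝ) :=
    polyCombo Y u * polyCombo Y v + polyCombo Y v * polyCombo Y u -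
      (2 : MvPolynomial σ ℝ) • polyCombo Y w with hXdef
  have hXe : ∀ i j, X i j = (polyCombo Y u * polyCombo Y v + polyCombo Y v * polyCombo Y u) i j -
      2 * polyCombo Y w i j := fun i j => by
    simp [hXdef]
  rw [← hXe]
  have hX : ∀ i j, X i j = X j i := fun i j => by
    simp only [hXe, Matrix.add_apply, Matrix.mul_apply, hY.polyCombo_symm w i j]
    rw [add_comm]
    congr 2 <;> refine Finset.sum_congr rfl fun k _ => ?_ <;>
      rw [hY.polyCombo_symm _ i k, hY.polyCombo_symm _ k j, mul_comm]
  have hprod : ∀ {x y : Fin d → ℝ}, (∀ a, |x a| ≤ K ^ 6) → (∀ a, |y a| ≤ K ^ 6) → ∀ i j,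
      BigO E K 1 2 17 ((polyCombo Y x * polyCombo Y y) i j) := fun hx hy i j => by
    rw [Matrix.mul_apply]
    exact hY.sum_r zero_le_one fun k =>
      (hY.polyCombo_bounded hx i k).mul (hY.polyCombo_bounded hy k j)
  have hXb : ∀ i j, BigO E K 1 2 19 (X i j) := fun i j => by
    rw [hXe]
    exact (((hprod hu hv i j).add hs (hprod hv hu i j)).sub hs
      ((BigO.two hs).mul (hY.polyCombo_bounded hw i j))).le hs (by norm_num) (by norm_num)
  -- Each trace is within the error of its true value, and the true values cancel by `h`.
  have hXY : ∀ a, BigO E K η (2 + 1) 24 ((X * Y a).trace) := fun a => by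
    have h1 := ((hY.trace_polyCombo_mul_mul hu hv a).add hs
      (hY.trace_polyCombo_mul_mul hv hu a)).sub hs
      ((BigO.two hs).mul_left (hY.trace_polyCombo_mul hw a))
    refine (h1.congr ?_).le hs (by norm_num) (by norm_num)
    have h2 := congrArg (fun M => (C (M * Qs a).trace : MvPolynomial σ ℝ)) h
    simp only [add_mul, Matrix.trace_add, Matrix.smul_mul, Matrix.trace_smul, smul_eq_mul, C_add,
      C_mul] at h2
    rw [show (C 2 : MvPolynomial σ ℝ) = 2 from map_ofNat C 2] at h2
    simp only [hXdef, sub_mul, add_mul, Matrix.trace_add, Matrix.trace_sub, Matrix.smul_mul,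
      Matrix.trace_smul, smul_eq_mul]
    linear_combination -h2
  exact (hY.small_of_trace_small hX hXb hXY i j).le hs (by norm_num) (by norm_num)

end ApproxSolution

end Jordan

/-! ### The diagonal symmetric units -/

/-- An approximate solution that is normalized like the ground truth; `c i j` are the coefficients
of the symmetric unit `symmUnit i j` in terms of the `Qs a`. -/
structure GaugedSolution {σ : Type} {d r : ℕ} (E : MvPolynomial σ ℝ →ₗ[ℝ] ℝ) (K η : ℝ)
    (Qs : Fin d → Matrix (Fin r) (Fin r) ℝ)
    (Y : Fin d → Matrix (Fin r) (Fin r) (MvPolynomial σ ℝ))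
    (L : UpperPairs r → Fin d → MvPolynomial σ ℝ) (c : Fin r → Fin r → Fin d → ℝ)
    (lam mu : Fin d → ℝ) : Prop extends ApproxSolution E K η Qs Y L where
  eta_le_one : η ≤ 1
  coeff_le : ∀ i j a, |c i j a| ≤ K
  coeff_symm : ∀ i j, c i j = c j i
  coeff_sum : ∀ i j, ∑ a, c i j a • Qs a = symmUnit i j
  lam_le : ∀ a, |lam a| ≤ 1
  mu_le : ∀ a, |mu a| ≤ 1
  entry_le : ∀ a i j, |Qs a i j| ≤ K
  symm_truth : ∀ a i j, Qs a i j = Qs a j i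
  lam_diag : ∀ i j, i ≠ j → (∑ a, lam a • Qs a) i j = 0
  lam_gap : ∀ i j, i < j → 1 ≤ K * ((∑ a, lam a • Qs a) j j - (∑ a, lam a • Qs a) i i)
  mu_firstRow : ∀ i j : Fin r, i.val = 0 → i < j → 1 ≤ K * (∑ a, mu a • Qs a) i j
  poly_diag : ∀ i j, i ≠ j → BigO E K η 1 1 (polyCombo Y lam i j)
  poly_sorted : ∀ i j, i < j → ∀ s : MvPolynomial σ ℝ, IsSumSq s → s.totalDegree ≤ 94 →
    0 ≤ E (s * (polyCombo Y lam j j - polyCombo Y lam i i))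
  poly_firstRow : ∀ i j : Fin r, i.val = 0 → ∀ s : MvPolynomial σ ℝ, IsSumSq s →
    s.totalDegree ≤ 94 → 0 ≤ E (s * polyCombo Y mu i j)

/-- If `a` has nearly constant row and column sums `x`, and is small on a block `R × C` that is too
large for a permutation matrix, then `x` is small. -/
theorem le_of_large_small_block {r : ℕ} {a : Fin r → Fin r → ℝ} {x e : ℝ} (ha : ∀ l m, 0 ≤ a l m)
    (hx : 0 ≤ x) (he : 0 ≤ e) (R C : Finset (Fin r)) (hcard : Rᶜ.card + 1 ≤ C.card)
    (hcol : ∀ m, x ≤ ∑ l, a l m + e) (hrow : ∀ l, ∑ m, a l m ≤ x + e)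
    (hblock : ∀ l ∈ R, ∀ m ∈ C, a l m ≤ e) : x ≤ (r + r + r * r) * e := by
  -- The columns in `C` carry mass about `C.card * x`. Little of it lies in `R`, and the other rows
  -- hold at most about `Rᶜ.card * x`; since `Rᶜ.card < C.card`, one `x` is left to be covered by
  -- errors.
  have h1 : C.card * x ≤ ∑ m ∈ C, ∑ l, a l m + C.card * e := by
    have := Finset.sum_le_sum fun m (_ : m ∈ C) => hcol m
    simpa [Finset.sum_add_distrib] using this
  have h2 : ∑ m ∈ C, ∑ l, a l m = ∑ l ∈ R, ∑ m ∈ C, a l m + ∑ l ∈ Rᶜ, ∑ m ∈ C, a l m := by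
    rw [Finset.sum_comm, Finset.sum_add_sum_compl]
  have h3 : ∑ l ∈ R, ∑ m ∈ C, a l m ≤ R.card * (C.card * e) := by
    have := Finset.sum_le_sum fun l (hl : l ∈ R) => Finset.sum_le_sum fun m hm => hblock l hl m hm
    simpa using this
  have h4 : ∑ l ∈ Rᶜ, ∑ m ∈ C, a l m ≤ Rᶜ.card * (x + e) := by
    have := Finset.sum_le_sum fun l (_ : l ∈ Rᶜ) =>
      (Finset.sum_le_univ_sum_of_nonneg (s := C) (ha l)).trans (hrow l)
    rwa [Finset.sum_const, nsmul_eq_mul] at this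
  have hc : ∀ s : Finset (Fin r), (s.card : ℝ) ≤ r := fun s => by
    exact_mod_cast (Finset.card_le_univ s).trans_eq (Fintype.card_fin r)
  have hcard' : (Rᶜ.card : ℝ) + 1 ≤ C.card := by exact_mod_cast hcard
  have h5 := mul_le_mul_of_nonneg_right hcard' hx
  have h6 := mul_le_mul_of_nonneg_right (hc C) he
  have h7 := mul_le_mul_of_nonneg_right (hc Rᶜ) he
  have h8 : (R.card : ℝ) * (C.card * e) ≤ r * (r * e) :=
    mul_le_mul (hc R) h6 (by positivity) (by positivity)
  nlinarith

theorem symmUnit_apply {r : ℕ} (i j k l : Fin r) : symmUnit i j k l =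
    (1 / 2) * ((if i = k ∧ j = l then 1 else 0) + (if j = k ∧ i = l then 1 else 0)) := by
  simp [symmUnit, Matrix.single_apply]

theorem symmUnit_self {r : ℕ} (j : Fin r) : symmUnit j j = Matrix.single j j 1 := by
  ext k l
  rw [symmUnit_apply, Matrix.single_apply]
  split_ifs <;> norm_num

section DiagonalUnits

variable {σ : Type} {d r : ℕ} {E : MvPolynomial σ ℝ →ₗ[ℝ] ℝ} {K η : ℝ}
  {Qs : Fin d → Matrix (Fin r) (Fin r) ℝ}
  {Y : Fin d → Matrix (Fin r) (Fin r) (MvPolynomial σ ℝ)}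
  {L : UpperPairs r → Fin d → MvPolynomial σ ℝ} {c : Fin r → Fin r → Fin d → ℝ}
  {lam mu : Fin d → ℝ}

theorem polyCombo_smul (x : ℝ) (u : Fin d → ℝ) (i j : Fin r) :
    polyCombo Y (fun a => x * u a) i j = C x * polyCombo Y u i j := by
  simp only [polyCombo_apply, C_mul, Finset.mul_sum, mul_assoc]

theorem polyCombo_sum {ι : Type*} (s : Finset ι) (u : ι → Fin d → ℝ) (i j : Fin r) :
    polyCombo Y (fun a => ∑ t ∈ s, u t a) i j = ∑ t ∈ s, polyCombo Y (u t) i j := by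
  simp only [polyCombo_apply, map_sum, Finset.sum_mul]
  exact Finset.sum_comm

theorem polyCombo_single (b : Fin d) :
    polyCombo Y (fun a => if a = b then 1 else 0) = Y b := by
  ext1 i j
  rw [polyCombo_apply]
  simp [apply_ite (C : ℝ → MvPolynomial σ ℝ)]

theorem sum_smul_sum {ι : Type*} (s : Finset ι) (u : ι → Fin d → ℝ) :
    ∑ a, (∑ t ∈ s, u t a) • Qs a = ∑ t ∈ s, ∑ a, u t a • Qs a := by
  simp only [Finset.sum_smul]
  exact Finset.sum_comm

theorem sum_mul_smul (x : ℝ) (u : Fin d → ℝ) :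
    ∑ a, (x * u a) • Qs a = x • ∑ a, u a • Qs a := by
  simp only [Finset.smul_sum, mul_smul]

/-! ### Row weights: a nearly doubly stochastic matrix. -/

/-- The squared norm of the `k`-th row of the image of `symmUnit j j`. -/
def rowWeight (Y : Fin d → Matrix (Fin r) (Fin r) (MvPolynomial σ ℝ))
    (c : Fin r → Fin r → Fin d → ℝ) (k j : Fin r) : MvPolynomial σ ℝ :=
  ∑ l, polyCombo Y (c j j) k l ^ 2

theorem rowWeight_isSumSq (k j : Fin r) : IsSumSq (rowWeight Y c k j) := IsSumSq.sum_sq _ _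

theorem sq_isSumSq (p : MvPolynomial σ ℝ) : IsSumSq (p ^ 2) := by
  rw [sq]; exact IsSumSq.mul_self p

theorem IsPseudoExpectation.nonneg_mul_sum_sq (hE : IsPseudoExpectation 96 E) {ι : Type*}
    (s : Finset ι) {p : MvPolynomial σ ℝ} {f : ι → MvPolynomial σ ℝ}
    (h : ∀ i ∈ s, (p * f i).totalDegree ≤ 48) : 0 ≤ E (p ^ 2 * ∑ i ∈ s, f i ^ 2) := by
  rw [Finset.mul_sum, map_sum]
  refine Finset.sum_nonneg fun i hi => ?_
  rw [← mul_pow]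
  exact hE.nonneg_sq (h i hi)

theorem abs_sum_le_pow {ι : Type*} (hs : 1 ≤ K) (s : Finset ι) (hι : (s.card : ℝ) ≤ K) {n : ℕ}
    {f : ι → ℝ} (h : ∀ i ∈ s, |f i| ≤ K ^ n) : |∑ i ∈ s, f i| ≤ K ^ (n + 1) := by
  refine (Finset.abs_sum_le_sum_abs _ _).trans ((Finset.sum_le_sum h).trans ?_)
  rw [Finset.sum_const, nsmul_eq_mul, pow_succ']
  exact mul_le_mul_of_nonneg_right hι (by positivity)

namespace GaugedSolution

variable (hY : GaugedSolution E K η Qs Y L c lam mu)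
include hY

theorem coeff_le_pow (i j : Fin r) (a : Fin d) : |c i j a| ≤ K ^ 6 :=
  (hY.coeff_le i j a).trans (le_self_pow₀ hY.scale.one_le (by norm_num))

theorem lam_le_pow (a : Fin d) : |lam a| ≤ K ^ 6 :=
  (hY.lam_le a).trans (one_le_pow₀ hY.scale.one_le)

theorem combo_entry_le {u : Fin d → ℝ} (hu : ∀ a, |u a| ≤ 1) (i j : Fin r) :
    |(∑ a, u a • Qs a) i j| ≤ K ^ 2 := by
  rw [Matrix.sum_apply]
  refine abs_sum_le_pow hY.scale.one_le _ (by simpa using hY.card_d) fun a _ => ?_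
  rw [Matrix.smul_apply, smul_eq_mul, abs_mul, pow_one]
  exact (mul_le_of_le_one_left (abs_nonneg _) (hu a)).trans (hY.entry_le a i j)

theorem one_coeff_le (a : Fin d) : |∑ m, c m m a| ≤ K ^ 6 :=
  (abs_sum_le_pow hY.scale.one_le _ (by simpa using hY.card_r) (n := 1)
    fun m _ => by simpa using hY.coeff_le m m a).trans
      (pow_le_pow_right₀ hY.scale.one_le (by norm_num))

theorem one_coeff_sum : ∑ a, (∑ m, c m m a) • Qs a = 1 := by
  rw [sum_smul_sum]
  simp only [hY.coeff_sum, symmUnit_self]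
  ext i j
  simp [Matrix.sum_apply, Matrix.single_apply, Matrix.one_apply, ite_and]

/-- Combinations of the `Y a` with the same ground truth are nearly equal. -/
theorem polyCombo_congr {u w : Fin d → ℝ} (hu : ∀ a, |u a| ≤ K ^ 6) (hw : ∀ a, |w a| ≤ K ^ 6)
    (h : ∑ a, u a • Qs a = ∑ a, w a • Qs a) (i j : Fin r) :
    BigO E K η 4 31 (polyCombo Y u i j - polyCombo Y w i j) := by
  -- The Jordan product of the image of the identity with `polyCombo Y u` is compared with
  -- `polyCombo Y u` and, by `h`, also with `polyCombo Y w`. This is how linear relations among the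
  -- `Qs a` pass to the `Y a`.
  have h1 := hY.jordan hY.one_coeff_le hu hu
    (by rw [hY.one_coeff_sum, one_mul, mul_one, two_smul]) i j
  have h2 := hY.jordan hY.one_coeff_le hu hw
    (by rw [hY.one_coeff_sum, one_mul, mul_one, ← h, two_smul]) i j
  refine (BigO.of_const_mul (m := 0) (a := 2) hY.scale (by norm_num) (by norm_num [abs_le])
    ((h2.sub hY.scale h1).congr ?_)).le hY.scale (by norm_num) (by norm_num)
  rw [map_ofNat]
  ring

/-- The image of the identity matrix has diagonal entries close to `1`. -/
theorem one_diag (k : Fin r) :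
    BigO E K η 5 36 (polyCombo Y (fun a => ∑ m, c m m a) k k - 1) := by
  have hs := hY.scale
  set J := polyCombo Y (fun a => ∑ m, c m m a) with hJ
  -- `J * Y a + Y a * J` is close to `2 * Y a`. Weighting the `(k, k)` entries by a row of `L` turns
  -- the left side into nearly `2 * J k k` and the right side into nearly 2.
  have h1 : BigO E K η 5 33 (∑ a, L (toUpper k k) a * ((J * Y a + Y a * J) k k - 2 * Y a k k)) := by
    refine hY.sum_d hY.eta_nonneg fun a => ?_
    have h : ∀ b, |(if b = a then (1 : ℝ) else 0)| ≤ K ^ 6 := fun b => by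
      have := one_le_pow₀ hs.one_le (n := 6)
      split_ifs
      · simpa using this
      · simpa using (zero_le_one.trans this)
    have h' := hY.jordan hY.one_coeff_le h h
      (by rw [hY.one_coeff_sum, one_mul, mul_one, two_smul]) k k
    rw [polyCombo_single] at h'
    exact (hY.bounded_left _ a).mul_left h'
  have h2 : BigO E K η 3 11 (∑ m, J k m * (∑ a, L (toUpper k k) a * Y a k m -
      C (if (k = k ∧ k = m) ∨ (k = m ∧ k = k) then 1 else 0))) :=
    hY.sum_r hY.eta_nonneg fun m =>
      (hY.polyCombo_bounded hY.one_coeff_le k m).mul_left (hY.left_inv k k k m)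
  have h3 := hY.left_inv k k k k
  have hJJ : ∀ a, (J * Y a + Y a * J) k k = 2 * ∑ m, J k m * Y a k m := fun a => by
    rw [Matrix.add_apply, Matrix.mul_apply, Matrix.mul_apply, ← Finset.sum_add_distrib,
      Finset.mul_sum]
    refine Finset.sum_congr rfl fun m _ => ?_
    rw [hY.symm a m k, hJ, hY.polyCombo_symm _ m k]
    ring
  refine (BigO.of_const_mul (m := 0) (a := 2) hs (by norm_num) (by norm_num [abs_le])
    (((h1.sub hs ((BigO.two hs).mul_left h2)).add hs
      ((BigO.two hs).mul_left h3)).congr ?_)).le hs (by norm_num) (by norm_num)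
  rw [map_ofNat]
  have e1 : ∑ a, L (toUpper k k) a * ((J * Y a + Y a * J) k k - 2 * Y a k k) =
      2 * ∑ m, J k m * ∑ a, L (toUpper k k) a * Y a k m -
        2 * ∑ a, L (toUpper k k) a * Y a k k := by
    have e3 : ∑ m, J k m * ∑ a, L (toUpper k k) a * Y a k m =
        ∑ a, L (toUpper k k) a * ∑ m, J k m * Y a k m := by
      simp only [Finset.mul_sum]
      rw [Finset.sum_comm]
      exact Finset.sum_congr rfl fun a _ => Finset.sum_congr rfl fun m _ => mul_left_comm _ _ _
    rw [e3, Finset.mul_sum, Finset.mul_sum, ← Finset.sum_sub_distrib]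
    exact Finset.sum_congr rfl fun a _ => by rw [hJJ]; ring
  have e2 : ∑ m, J k m * C (σ := σ) (R := ℝ)
      (if (k = k ∧ k = m) ∨ (k = m ∧ k = k) then 1 else 0) = J k k := by
    simp [apply_ite (C : ℝ → MvPolynomial σ ℝ)]
  rw [e1]
  rw [Finset.sum_congr rfl fun m _ => mul_sub (J k m) _ _, Finset.sum_sub_distrib, e2,
    if_pos (Or.inl ⟨rfl, rfl⟩), C_1]
  ring

theorem unit_bounded (i j k l : Fin r) : BigO E K 1 1 8 (polyCombo Y (c i j) k l) :=
  hY.polyCombo_bounded (hY.coeff_le_pow i j) k l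

theorem rowWeight_bounded (k j : Fin r) : BigO E K 1 2 17 (rowWeight Y c k j) :=
  hY.sum_r zero_le_one fun l =>
    ((hY.unit_bounded j j k l).mul (hY.unit_bounded j j k l)).congr (sq _).symm

/-- `symmUnit j j` is idempotent, so its image nearly is; by symmetry the row weight is a diagonal
entry of the squared image. -/
theorem rowWeight_sub_diag (k j : Fin r) :
    BigO E K η 4 30 (rowWeight Y c k j - polyCombo Y (c j j) k k) := by
  have h := hY.jordan (hY.coeff_le_pow j j) (hY.coeff_le_pow j j) (hY.coeff_le_pow j j)
    (by rw [hY.coeff_sum, symmUnit_self, Matrix.single_mul_single_same, one_mul, two_smul]) k k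
  refine (BigO.of_const_mul (m := 0) (a := 2) hY.scale (by norm_num) (by norm_num [abs_le])
    (h.congr ?_)).le hY.scale le_rfl (by norm_num)
  rw [map_ofNat, rowWeight, Matrix.add_apply, Matrix.mul_apply, mul_sub, two_mul]
  simp only [hY.polyCombo_symm (c j j) _ k, ← sq]
  ring

/-- The column sum is the trace of the squared image of `symmUnit j j`, a second moment whose true
value is 1. -/
theorem rowWeight_colSum (j : Fin r) : BigO E K η 2 19 (∑ k, rowWeight Y c k j - 1) := by
  have h : BigO E K η 2 19 (∑ a, C (c j j a) * ((polyCombo Y (c j j) * Y a).trace -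
      C ((∑ b, c j j b • Qs b) * Qs a).trace)) :=
    hY.sum_d hY.eta_nonneg fun a => (BigO.const hY.scale (hY.coeff_le_pow j j a)).mul_left
      (hY.trace_polyCombo_mul (hY.coeff_le_pow j j) a)
  refine h.congr ?_
  simp only [mul_sub, Finset.sum_sub_distrib]
  congr 1
  · have e : (polyCombo Y (c j j) * polyCombo Y (c j j)).trace = ∑ k, rowWeight Y c k j := by
      simp only [Matrix.trace, Matrix.diag, Matrix.mul_apply, rowWeight]
      exact Finset.sum_congr rfl fun k _ => Finset.sum_congr rfl fun l _ => by
        rw [hY.polyCombo_symm _ l k, sq]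
    rw [← e]
    conv_rhs => rw [Matrix.trace_mul_comm, polyCombo, trace_sum_mul]
    exact Finset.sum_congr rfl fun a _ => by rw [Matrix.trace_mul_comm]; rfl
  · have e : ((∑ b, c j j b • Qs b) * (∑ b, c j j b • Qs b)).trace = 1 := by
      rw [hY.coeff_sum, symmUnit_self, Matrix.single_mul_single_same, Matrix.trace_single_eq_same,
        one_mul]
    rw [trace_sum_mul] at e
    rw [← C_1, ← e, map_sum]
    exact Finset.sum_congr rfl fun a _ => by rw [C_mul, Matrix.trace_mul_comm]

/-- By `rowWeight_sub_diag` and linearity, the row sum is nearly a diagonal entry of the image of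
the identity. -/
theorem rowWeight_rowSum (k : Fin r) : BigO E K η 5 37 (∑ j, rowWeight Y c k j - 1) := by
  have h1 := hY.sum_r hY.eta_nonneg fun j => hY.rowWeight_sub_diag k j
  refine ((h1.add hY.scale (hY.one_diag k)).congr ?_).le hY.scale (by norm_num) (by norm_num)
  rw [polyCombo_sum, Finset.sum_sub_distrib]
  ring

/-- `symmUnit j j` is an eigenvector of Jordan multiplication by the true `Q_lam`. The relation is
read at `(k, k)`, where the near-diagonality of `polyCombo Y lam` leaves a single product. -/
theorem rowWeight_mul_eigen (k j : Fin r) : BigO E K η 5 40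
    (rowWeight Y c k j * (polyCombo Y lam k k - C ((∑ a, lam a • Qs a) j j))) := by
  have hs := hY.scale
  set ev := (∑ a, lam a • Qs a) j j with hev
  set F := polyCombo Y (c j j) with hF
  set t := polyCombo Y lam with ht
  have hevb : |ev| ≤ K ^ 2 := hY.combo_entry_le hY.lam_le j j
  have h1 := hY.jordan (w := fun a => ev * c j j a) hY.lam_le_pow (hY.coeff_le_pow j j)
    (fun a => by
      rw [abs_mul]
      calc |ev| * |c j j a| ≤ K ^ 2 * K :=
            mul_le_mul hevb (hY.coeff_le j j a) (abs_nonneg _) (pow_pos hs.pos 2).le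
        _ = K ^ 3 := by ring
        _ ≤ K ^ 6 := pow_le_pow_right₀ hs.one_le (by norm_num))
    (by
      rw [sum_mul_smul, hY.coeff_sum, symmUnit_self]
      have hd : ∑ a, lam a • Qs a = Matrix.diagonal fun i => (∑ a, lam a • Qs a) i i := by
        ext i i'
        by_cases hii : i = i'
        · subst hii; rw [Matrix.diagonal_apply_eq]
        · rw [hY.lam_diag i i' hii, Matrix.diagonal_apply_ne _ hii]
      rw [hd]
      ext i i'
      simp only [Matrix.add_apply, Matrix.diagonal_mul, Matrix.mul_diagonal, Matrix.smul_apply,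
        Matrix.single_apply, smul_eq_mul]
      split_ifs with hj
      · rw [← hj.1, ← hj.2, hev]; ring
      · ring) k k
  rw [polyCombo_smul] at h1
  have h2 : BigO E K η 2 10 (∑ m, if m = k then 0 else t k m * F m k) := by
    refine hY.sum_r hY.eta_nonneg fun m => ?_
    split_ifs with hm
    · exact (BigO.zero hs hY.eta_nonneg).le hs (by norm_num) (by norm_num)
    · exact (hY.poly_diag k m (Ne.symm hm)).mul (hY.unit_bounded j j m k)
  have h3 : BigO E K η 4 31 (F k k * (t k k - C ev)) := by
    refine (BigO.of_const_mul (m := 0) (a := 2) hs (by norm_num) (by norm_num [abs_le])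
      ((h1.sub hs ((BigO.two hs).mul_left h2)).congr ?_)).le hs (by norm_num) (by norm_num)
    have e1 : (F * t) k k = (t * F) k k := by
      simp only [Matrix.mul_apply]
      exact Finset.sum_congr rfl fun m _ => by
        rw [hF, ht, hY.polyCombo_symm _ k m, hY.polyCombo_symm lam k m, mul_comm]
    have e2 : (t * F) k k = t k k * F k k + ∑ m, if m = k then 0 else t k m * F m k := by
      rw [Matrix.mul_apply, ← Finset.add_sum_erase _ _ (Finset.mem_univ k),
        ← Finset.add_sum_erase (a := k) Finset.univ (fun m => if m = k then 0 else t k m * F m k)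
          (Finset.mem_univ k), if_pos rfl, zero_add]
      congr 1
      exact Finset.sum_congr rfl fun m hm => by rw [if_neg (Finset.ne_of_mem_erase hm)]
    rw [Matrix.add_apply, e1, e2, map_ofNat]
    ring
  have h4 : BigO E K 1 1 9 (t k k - C ev) :=
    ((hY.polyCombo_bounded hY.lam_le_pow k k).sub hs (BigO.const hs hevb)).le hs
      (by norm_num) (by norm_num)
  exact (((hY.rowWeight_sub_diag k j).mul h4).add hs h3 |>.congr (by ring)).le hs
    (by norm_num) (by norm_num)

theorem rowWeight_mul_nonneg {p : MvPolynomial σ ℝ} (hp : p.totalDegree + 2 ≤ 48)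
    (k j l m : Fin r) : 0 ≤ E (p ^ 2 * (rowWeight Y c k j * rowWeight Y c l m)) := by
  have e : p ^ 2 * (rowWeight Y c k j * rowWeight Y c l m) =
      p ^ 2 * ∑ x : Fin r × Fin r,
        (polyCombo Y (c j j) k x.1 * polyCombo Y (c m m) l x.2) ^ 2 := by
    rw [rowWeight, rowWeight, Finset.sum_mul_sum, ← Finset.univ_product_univ,
      Finset.sum_product]
    simp only [mul_pow]
  rw [e]
  refine hY.scale.pseudo.nonneg_mul_sum_sq _ fun x _ => ?_
  exact (totalDegree_mul_le le_rfl (totalDegree_mul_le (hY.unit_bounded j j k x.1).degree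
    (hY.unit_bounded m m l x.2).degree)).trans hp

theorem rowWeight_nonneg {p : MvPolynomial σ ℝ} (hp : p.totalDegree + 1 ≤ 48)
    (k j : Fin r) : 0 ≤ E (p ^ 2 * rowWeight Y c k j) :=
  hY.scale.pseudo.nonneg_mul_sum_sq _ fun l _ =>
    (totalDegree_mul_le le_rfl (hY.unit_bounded j j k l).degree).trans hp

/-- Inversions have small weight. -/
theorem inversion_small {p : MvPolynomial σ ℝ} (hp : p.totalDegree + 7 ≤ 48) {k l m j : Fin r}
    (hkl : k ≤ l) (hmj : m < j) :
    E (p ^ 2 * (rowWeight Y c k j * rowWeight Y c l m)) ≤ K ^ 59 * η * E (p ^ 2) := by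
  have hs := hY.scale
  set ev : Fin r → ℝ := fun i => (∑ a, lam a • Qs a) i i with hev
  set t := polyCombo Y lam with ht
  -- Subtracting the two eigenvalue relations gives the product of weights times `(t l l - t k k) +
  -- (ev j - ev m)`. The first bracket contributes nonnegatively by the sorting constraint and the
  -- second is at least `1 / K`, so the product of weights itself is small.
  have h1 : BigO E K η 7 58 (rowWeight Y c k j * (rowWeight Y c l m * (t l l - C (ev m))) -
      rowWeight Y c l m * (rowWeight Y c k j * (t k k - C (ev j)))) :=
    (((hY.rowWeight_bounded k j).mul_left (hY.rowWeight_mul_eigen l m)).sub hs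
      ((hY.rowWeight_bounded l m).mul_left (hY.rowWeight_mul_eigen k j))).le hs
        (by norm_num) (by norm_num)
  have h2 := (abs_le.mp (h1.abs_le hs hp)).2
  have h3 : 0 ≤ E (p ^ 2 * (rowWeight Y c k j * rowWeight Y c l m) * (t l l - t k k)) := by
    rcases hkl.eq_or_lt with h | h
    · rw [h, sub_self, mul_zero, map_zero]
    · refine hY.poly_sorted k l h _ ((sq_isSumSq p).mul
        ((rowWeight_isSumSq k j).mul (rowWeight_isSumSq l m))) ?_
      have := totalDegree_mul_le (totalDegree_sq_le (le_refl p.totalDegree))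
        (totalDegree_mul_le (hY.rowWeight_bounded k j).degree (hY.rowWeight_bounded l m).degree)
      omega
  have e : p ^ 2 * (rowWeight Y c k j * (rowWeight Y c l m * (t l l - C (ev m))) -
      rowWeight Y c l m * (rowWeight Y c k j * (t k k - C (ev j)))) =
      p ^ 2 * (rowWeight Y c k j * rowWeight Y c l m) * (t l l - t k k) +
        (ev j - ev m) • (p ^ 2 * (rowWeight Y c k j * rowWeight Y c l m)) := by
    rw [smul_eq_C_mul, C_sub]
    ring
  rw [e, map_add, map_smul, smul_eq_mul] at h2
  have h4 := hY.rowWeight_mul_nonneg (p := p) (by omega) k j l m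
  set w := E (p ^ 2 * (rowWeight Y c k j * rowWeight Y c l m))
  have h5 : 1 ≤ K * (ev j - ev m) := hY.lam_gap m j hmj
  calc w ≤ K * (ev j - ev m) * w := le_mul_of_one_le_left h4 h5
    _ = K * ((ev j - ev m) * w) := by ring
    _ ≤ K * (K ^ 58 * η * E (p ^ 2)) := mul_le_mul_of_nonneg_left (by linarith) hs.pos.le
    _ = _ := by ring

/-- With `(k, j)` fixed, the numbers `E (p ^ 2 * (rowWeight Y c k j * rowWeight Y c l m))` form a
matrix in `(l, m)` whose row and column sums are nearly `x = E (p ^ 2 * rowWeight Y c k j)`. The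
inversions with `(k, j)` form a small block too large for a permutation, so `x` is small. -/
theorem rowWeight_small {p : MvPolynomial σ ℝ} (hp : p.totalDegree + 7 ≤ 48) {k j : Fin r}
    (hkj : k ≠ j) : E (p ^ 2 * rowWeight Y c k j) ≤ K ^ 63 * η * E (p ^ 2) := by
  have hs := hY.scale
  have hX : 0 ≤ E (p ^ 2) := hs.pseudo.nonneg_sq (by omega)
  set e := K ^ 60 * η * E (p ^ 2) with he
  have he0 : 0 ≤ e := mul_nonneg (mul_nonneg (pow_pos hs.pos _).le hY.eta_nonneg) hX
  have hbound : ∀ {f : MvPolynomial σ ℝ} {n : ℕ}, n ≤ 60 → BigO E K η 7 n f →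
      |E (p ^ 2 * f)| ≤ e := fun hn hf => (hf.le hs le_rfl hn).abs_le hs hp
  have hinv : ∀ {k l m j : Fin r}, k ≤ l → m < j →
      E (p ^ 2 * (rowWeight Y c k j * rowWeight Y c l m)) ≤ e := fun hkl hmj =>
    (hY.inversion_small hp hkl hmj).trans (mul_le_mul_of_nonneg_right
      (mul_le_mul_of_nonneg_right (pow_le_pow_right₀ hs.one_le (by norm_num)) hY.eta_nonneg) hX)
  have hcol : ∀ m, E (p ^ 2 * rowWeight Y c k j) ≤
      ∑ l, E (p ^ 2 * (rowWeight Y c k j * rowWeight Y c l m)) + e := fun m => by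
    have h := (abs_le.mp (hbound (n := 36) (by norm_num) (((hY.rowWeight_bounded k j).mul_left
      (hY.rowWeight_colSum m)).le hs (by norm_num) (by norm_num)))).1
    rw [mul_sub, mul_one, mul_sub, Finset.mul_sum, Finset.mul_sum, map_sub, map_sum] at h
    linarith
  have hrow : ∀ l, ∑ m, E (p ^ 2 * (rowWeight Y c k j * rowWeight Y c l m)) ≤
      E (p ^ 2 * rowWeight Y c k j) + e := fun l => by
    have h := (abs_le.mp (hbound (n := 54) (by norm_num) ((hY.rowWeight_bounded k j).mul_left
      (hY.rowWeight_rowSum l)))).2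
    rw [mul_sub, mul_one, mul_sub, Finset.mul_sum, Finset.mul_sum, map_sub, map_sum] at h
    linarith
  have hpos := fun l m => hY.rowWeight_mul_nonneg (p := p) (by omega) k j l m
  have hx := hY.rowWeight_nonneg (p := p) (by omega) k j
  have main : E (p ^ 2 * rowWeight Y c k j) ≤ (r + r + r * r) * e := by
    -- For `k < j`, the rows outside the block number `k`, fewer than its `j` columns. For `j < k`
    -- the block is reflected: `r - 1 - k` rows outside against `r - 1 - j` columns.
    rcases hkj.lt_or_gt with h | h
    · refine le_of_large_small_block hpos hx he0 (Finset.Ici k) (Finset.Iio j) ?_ hcol hrow ?_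
      · rw [Finset.card_compl, Fin.card_Ici, Fin.card_Iio, Fintype.card_fin]
        have := k.2
        omega
      · intro l hl m hm
        exact hinv (Finset.mem_Ici.mp hl) (Finset.mem_Iio.mp hm)
    · refine le_of_large_small_block hpos hx he0 (Finset.Iic k) (Finset.Ioi j) ?_ hcol hrow ?_
      · rw [Finset.card_compl, Fin.card_Iic, Fin.card_Ioi, Fintype.card_fin]
        have := k.2
        omega
      · intro l hl m hm
        rw [mul_comm (rowWeight Y c k j)]
        exact hinv (Finset.mem_Iic.mp hl) (Finset.mem_Ioi.mp hm)
  have hr : (r + r + r * r : ℝ) ≤ K ^ 3 := by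
    have h1 := hY.card_r
    have h2 := hs.four_le
    have h3 : (0 : ℝ) ≤ r := Nat.cast_nonneg r
    nlinarith [mul_le_mul h1 h1 h3 hs.pos.le, mul_nonneg hs.pos.le hs.pos.le]
  calc _ ≤ _ := main
    _ ≤ K ^ 3 * e := mul_le_mul_of_nonneg_right hr he0
    _ = _ := by rw [he]; ring

/-- One square is at most the whole row weight; its root costs `√η`. The entry has degree at most 1,
while the 7 records the degree that the argument for `rowWeight_small` consumes. -/
theorem unit_diag_row_small {k j : Fin r} (hkj : k ≠ j) (l : Fin r) :
    BigO E K (√η) 7 63 (polyCombo Y (c j j) k l) := by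
  refine BigO.of_sq hY.scale (Real.sqrt_nonneg η) (Real.sq_sqrt hY.eta_nonneg)
    ((hY.unit_bounded j j k l).degree.trans (by norm_num)) fun p hp => ?_
  refine le_trans ?_ (hY.rowWeight_small hp hkj)
  rw [rowWeight, ← Finset.add_sum_erase _ _ (Finset.mem_univ l), mul_add, map_add]
  exact le_add_of_nonneg_right (hY.scale.pseudo.nonneg_mul_sum_sq _ fun l _ =>
    (totalDegree_mul_le le_rfl (hY.unit_bounded j j k l).degree).trans (by omega))

theorem eta_le_sqrt : η ≤ √η :=
  Real.le_sqrt_of_sq_le (by nlinarith [hY.eta_nonneg, hY.eta_le_one])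

/-- Rows other than `j` are small, and so by symmetry are the other columns. The `(j, j)` entry is
nearly its own row weight, which is nearly 1 because the column sum is and the other weights are
small. -/
theorem unit_diag (j k l : Fin r) :
    BigO E K (√η) 8 76 (polyCombo Y (c j j) k l - C (symmUnit j j k l)) := by
  have hs := hY.scale
  rw [symmUnit_self]
  by_cases hk : k = j
  · by_cases hl : l = j
    · subst hk hl
      rw [Matrix.single_apply_same, C_1]
      have h1 := ((hY.rowWeight_colSum l).weaken hs hY.eta_le_sqrt)
      have h2 := ((hY.rowWeight_sub_diag l l).weaken hs hY.eta_le_sqrt)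
      have h3 : BigO E K (√η) 8 73 (∑ k ∈ Finset.univ.erase l, rowWeight Y c k l) := by
        refine BigO.sum hs _ ?_ (Real.sqrt_nonneg η) fun k hk => ?_
        · refine le_trans ?_ hY.card_r
          exact_mod_cast (Finset.card_le_univ _).trans_eq (Fintype.card_fin r)
        · refine hY.sum_r (Real.sqrt_nonneg η) fun m => ?_
          exact ((hY.unit_diag_row_small (Finset.ne_of_mem_erase hk) m).mul
            (hY.unit_bounded l l k m)).congr (sq _).symm
      refine (((h1.sub hs h2).sub hs h3).congr ?_).le hs (by norm_num) (by norm_num)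
      rw [← Finset.add_sum_erase _ _ (Finset.mem_univ l)]
      ring
    · rw [hY.polyCombo_symm, Matrix.single_apply, if_neg (fun h => hl h.2.symm), C_0, sub_zero]
      exact (hY.unit_diag_row_small hl k).le hs (by norm_num) (by norm_num)
  · rw [Matrix.single_apply, if_neg (fun h => hk h.1.symm), C_0, sub_zero]
    exact (hY.unit_diag_row_small hk l).le hs (by norm_num) (by norm_num)

end GaugedSolution

end DiagonalUnits

/-! ### The off-diagonal symmetric units -/

theorem sum_mul_symmUnit {r : ℕ} (A : Matrix (Fin r) (Fin r) ℝ) (hA : ∀ i j, A i j = A j i) :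
    ∑ k, ∑ l, A k l • symmUnit k l = A := by
  ext i j
  simp only [Matrix.sum_apply, Matrix.smul_apply, symmUnit_apply, smul_eq_mul, mul_add,
    Finset.sum_add_distrib]
  have e1 : ∑ k, ∑ l, A k l * (1 / 2 * if k = i ∧ l = j then (1 : ℝ) else 0) = A i j / 2 := by
    rw [Finset.sum_eq_single_of_mem i (Finset.mem_univ _),
      Finset.sum_eq_single_of_mem j (Finset.mem_univ _)]
    · simp [div_eq_mul_inv]
    · intro l _ hl; simp [hl]
    · intro k _ hk; simp [hk]
  have e2 : ∑ k, ∑ l, A k l * (1 / 2 * if l = i ∧ k = j then (1 : ℝ) else 0) = A j i / 2 := by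
    rw [Finset.sum_eq_single_of_mem j (Finset.mem_univ _),
      Finset.sum_eq_single_of_mem i (Finset.mem_univ _)]
    · simp [div_eq_mul_inv]
    · intro l _ hl; simp [hl]
    · intro k _ hk; simp [hk]
  rw [e1, e2, hA j i]
  ring

/-- This and the next two relations determine the images of off-diagonal units: respectively their
support, their size, and the compatibility of their signs. -/
theorem symmUnit_jordan_diag {r : ℕ} {i j : Fin r} (hij : i ≠ j) :
    symmUnit i i * symmUnit i j + symmUnit i j * symmUnit i i =
      (2 : ℝ) • ((1 / 2 : ℝ) • symmUnit i j) := by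
  simp only [symmUnit, add_mul, mul_add, Matrix.smul_mul, Matrix.mul_smul,
    Matrix.single_mul_single_same, Matrix.single_mul_single_of_ne _ _ _ _ hij,
    Matrix.single_mul_single_of_ne _ _ _ _ hij.symm, mul_one]
  module

theorem symmUnit_jordan_sq {r : ℕ} {i j : Fin r} (hij : i ≠ j) :
    symmUnit i j * symmUnit i j + symmUnit i j * symmUnit i j =
      (2 : ℝ) • ((1 / 4 : ℝ) • (symmUnit i i + symmUnit j j)) := by
  simp only [symmUnit, add_mul, mul_add, Matrix.smul_mul, Matrix.mul_smul,
    Matrix.single_mul_single_same, Matrix.single_mul_single_of_ne _ _ _ _ hij,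
    Matrix.single_mul_single_of_ne _ _ _ _ hij.symm, mul_one]
  module

theorem symmUnit_jordan_path {r : ℕ} {z j k : Fin r} (hj : z ≠ j) (hk : z ≠ k) (hjk : j ≠ k) :
    symmUnit z j * symmUnit z k + symmUnit z k * symmUnit z j =
      (2 : ℝ) • ((1 / 4 : ℝ) • symmUnit j k) := by
  simp only [symmUnit, add_mul, mul_add, Matrix.smul_mul, Matrix.mul_smul,
    Matrix.single_mul_single_same, Matrix.single_mul_single_of_ne _ _ _ _ hj,
    Matrix.single_mul_single_of_ne _ _ _ _ hj.symm, Matrix.single_mul_single_of_ne _ _ _ _ hk,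
    Matrix.single_mul_single_of_ne _ _ _ _ hk.symm, Matrix.single_mul_single_of_ne _ _ _ _ hjk,
    Matrix.single_mul_single_of_ne _ _ _ _ hjk.symm, mul_one]
  module

section OffDiagonalUnits

variable {σ : Type} {d r : ℕ} {E : MvPolynomial σ ℝ →ₗ[ℝ] ℝ} {K η : ℝ}
  {Qs : Fin d → Matrix (Fin r) (Fin r) ℝ}
  {Y : Fin d → Matrix (Fin r) (Fin r) (MvPolynomial σ ℝ)}
  {L : UpperPairs r → Fin d → MvPolynomial σ ℝ} {c : Fin r → Fin r → Fin d → ℝ}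
  {lam mu : Fin d → ℝ}

theorem polyCombo_add (u v : Fin d → ℝ) (i j : Fin r) :
    polyCombo Y (fun a => u a + v a) i j = polyCombo Y u i j + polyCombo Y v i j := by
  simp only [polyCombo_apply, C_add, add_mul, Finset.sum_add_distrib]

namespace GaugedSolution

variable (hY : GaugedSolution E K η Qs Y L c lam mu)
include hY

theorem unit_mul_self_sub (i k m : Fin r) {f : MvPolynomial σ ℝ} (hf : BigO E K 1 1 8 f) :
    BigO E K (√η) 9 84 (polyCombo Y (c i i) k m * f - C (symmUnit i i k m) * f) :=
  ((hY.unit_diag i k m).mul hf).congr (sub_mul _ _ _)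

/-- Since the image of `symmUnit i i` is nearly the true unit, `symmUnit_jordan_diag` says that the
`(k, l)` entry times `[k = i] + [l = i] - 1` nearly vanishes. Under `h` this factor is `1` or `-1`.
-/
theorem unit_offdiag_small_left {i j : Fin r} (hij : i ≠ j) {k l : Fin r} (h : k = i ↔ l = i) :
    BigO E K (√η) 9 90 (polyCombo Y (c i j) k l) := by
  have hs := hY.scale
  have h1 := (hY.jordan (w := fun a => 1 / 2 * c i j a) (hY.coeff_le_pow i i)
    (hY.coeff_le_pow i j)
    (fun a => by
      rw [abs_mul]
      exact (mul_le_of_le_one_left (abs_nonneg _) (by norm_num [abs_le])).trans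
        (hY.coeff_le_pow i j a))
    (by rw [sum_mul_smul, hY.coeff_sum, hY.coeff_sum, symmUnit_jordan_diag hij]) k l).weaken hs
      hY.eta_le_sqrt
  rw [polyCombo_smul] at h1
  have h2 : BigO E K (√η) 9 86 ((polyCombo Y (c i i) * polyCombo Y (c i j) +
      polyCombo Y (c i j) * polyCombo Y (c i i)) k l -
        C ((if k = i then 1 else 0) + (if l = i then 1 else 0)) * polyCombo Y (c i j) k l) := by
    have h3 := hY.sum_r (Real.sqrt_nonneg η) fun m =>
      hY.unit_mul_self_sub i k m (hY.unit_bounded i j m l)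
    have h4 := hY.sum_r (Real.sqrt_nonneg η) fun m =>
      hY.unit_mul_self_sub i m l (hY.unit_bounded i j k m)
    refine ((h3.add hs h4).congr ?_).le hs (by norm_num) (by norm_num)
    have e1 : ∑ m, C (symmUnit i i k m) * polyCombo Y (c i j) m l =
        C (if k = i then 1 else 0) * polyCombo Y (c i j) k l := by
      rw [Finset.sum_eq_single_of_mem k (Finset.mem_univ _)]
      · rw [symmUnit_self, Matrix.single_apply]
        simp [eq_comm]
      · intro m _ hm
        rw [symmUnit_self, Matrix.single_apply, if_neg (fun h => hm (h.2.symm.trans h.1)), C_0,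
          zero_mul]
    have e2 : ∑ m, C (symmUnit i i m l) * polyCombo Y (c i j) k m =
        C (if l = i then 1 else 0) * polyCombo Y (c i j) k l := by
      rw [Finset.sum_eq_single_of_mem l (Finset.mem_univ _)]
      · rw [symmUnit_self, Matrix.single_apply]
        simp [eq_comm]
      · intro m _ hm
        rw [symmUnit_self, Matrix.single_apply, if_neg (fun h => hm (h.1.symm.trans h.2)), C_0,
          zero_mul]
    simp only [Finset.sum_sub_distrib, e1, e2]
    rw [Matrix.add_apply, Matrix.mul_apply, Matrix.mul_apply, C_add,
      Finset.sum_congr rfl fun m _ => mul_comm (polyCombo Y (c i j) k m) _]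
    ring
  have e3 : (2 : MvPolynomial σ ℝ) * C (1 / 2) = 1 := by
    rw [← map_ofNat C 2, ← C_mul]; norm_num
  refine (BigO.of_const_mul (m := 0) (a := (if k = i then 1 else 0) + (if l = i then 1 else 0) - 1)
    hs ?_ ?_ ((h1.sub hs h2).congr ?_)).le hs (by norm_num) (by norm_num)
  · by_cases hk : k = i <;> simp [hk, ← h]
  · by_cases hk : k = i <;> simp [hk, ← h]
  · rw [C_sub, C_1]
    linear_combination (-polyCombo Y (c i j) k l) * e3

/-- Apart from `(i, j)` and `(j, i)`, every position meets the criterion of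
`unit_offdiag_small_left` for `i` or for `j`. -/
theorem unit_offdiag_small {i j : Fin r} (hij : i ≠ j) {k l : Fin r} (h1 : ¬ (k = i ∧ l = j))
    (h2 : ¬ (k = j ∧ l = i)) : BigO E K (√η) 9 90 (polyCombo Y (c i j) k l) := by
  by_cases h : k = i ↔ l = i
  · exact hY.unit_offdiag_small_left hij h
  · have h' : k = j ↔ l = j := by
      by_cases hk : k = i
      · have hl : l ≠ j := fun hl => h1 ⟨hk, hl⟩
        have hk' : k ≠ j := fun hk' => hij (hk.symm.trans hk')
        simp [hl, hk']
      · have hl : l = i := by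
          by_contra hl
          exact h (by simp [hk, hl])
        have hk' : k ≠ j := fun hk' => h2 ⟨hk', hl⟩
        have hl' : l ≠ j := fun hl' => hij (hl.symm.trans hl')
        simp [hk', hl']
    rw [hY.coeff_symm i j]
    exact hY.unit_offdiag_small_left hij.symm h'

/-- The scalar by which `symmUnit i j` is multiplied has square close to `1`. -/
theorem scalar_sq {i j : Fin r} (hij : i ≠ j) :
    BigO E K (√η) 10 106 (polyCombo Y (c i j) i j ^ 2 - C (1 / 4)) := by
  have hs := hY.scale
  have h1 := (hY.jordan (w := fun a => 1 / 4 * (c i i a + c j j a)) (hY.coeff_le_pow i j)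
    (hY.coeff_le_pow i j)
    (fun a => by
      have h1 := hY.coeff_le i i a
      have h2 := hY.coeff_le j j a
      have h3 := abs_add_le (c i i a) (c j j a)
      have h4 := le_self_pow₀ hs.one_le (n := 6) (by norm_num)
      rw [abs_mul, abs_of_pos (by norm_num : (0 : ℝ) < 1 / 4)]
      linarith [hs.pos])
    (by
      rw [sum_mul_smul, hY.coeff_sum, symmUnit_jordan_sq hij, ← hY.coeff_sum i i,
        ← hY.coeff_sum j j, ← Finset.sum_add_distrib]
      simp only [add_smul]) i i).weaken hs hY.eta_le_sqrt
  rw [polyCombo_smul, polyCombo_add] at h1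
  -- In the `(i, i)` entry of the squared image only `m = j` survives. The value is `1 / 4` because
  -- `symmUnit i j` has entries `1 / 2`.
  have h2 : BigO E K (√η) 10 99 (∑ m ∈ Finset.univ.erase j, polyCombo Y (c i j) i m ^ 2) := by
    refine BigO.sum hs _ ?_ (Real.sqrt_nonneg η) fun m hm => ?_
    · refine le_trans ?_ hY.card_r
      exact_mod_cast (Finset.card_le_univ _).trans_eq (Fintype.card_fin r)
    · exact ((hY.unit_offdiag_small hij (fun h => Finset.ne_of_mem_erase hm h.2)
        (fun h => hij h.1)).mul (hY.unit_bounded i j i m)).congr (sq _).symm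
  have h3 := hY.unit_diag i i i
  have h4 := hY.unit_diag j i i
  rw [symmUnit_self, Matrix.single_apply_same] at h3
  rw [symmUnit_self, Matrix.single_apply, if_neg (fun h => hij h.1.symm), C_0, sub_zero] at h4
  have hq : BigO E K 1 0 0 (C (1 / 4) : MvPolynomial σ ℝ) :=
    BigO.const hs (by norm_num [abs_le])
  refine (BigO.of_const_mul (m := 0) (a := 2) hs (by norm_num) (by norm_num [abs_le])
    (((h1.sub hs ((BigO.two hs).mul_left h2)).add hs
      ((BigO.two hs).mul_left (hq.mul_left (h3.add hs h4)))).congr ?_)).le hs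
        (by norm_num) (by norm_num)
  have e : (polyCombo Y (c i j) * polyCombo Y (c i j)) i i = polyCombo Y (c i j) i j ^ 2 +
      ∑ m ∈ Finset.univ.erase j, polyCombo Y (c i j) i m ^ 2 := by
    rw [Finset.add_sum_erase _ (fun m => polyCombo Y (c i j) i m ^ 2) (Finset.mem_univ j),
      Matrix.mul_apply]
    exact Finset.sum_congr rfl fun m _ => by rw [hY.polyCombo_symm _ m i, sq]
  rw [Matrix.add_apply, e, map_ofNat, C_1]
  ring

/-- Every combination of the `Y a` nearly equals the expansion of its ground truth in the images of
the symmetric units. -/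
theorem expansion {u : Fin d → ℝ} (hu : ∀ a, |u a| ≤ 1) (i j : Fin r) :
    BigO E K η 4 31 (polyCombo Y u i j -
      ∑ k, ∑ l, C ((∑ a, u a • Qs a) k l) * polyCombo Y (c k l) i j) := by
  have hs := hY.scale
  set A := ∑ a, u a • Qs a with hA
  have hsymm : ∀ i j, A i j = A j i := fun i j => by
    simp only [hA, Matrix.sum_apply, Matrix.smul_apply, hY.symm_truth _ i j]
  have hcard : ((Finset.univ : Finset (Fin r)).card : ℝ) ≤ K := by simpa using hY.card_r
  have h := hY.polyCombo_congr (u := u) (w := fun a => ∑ k, ∑ l, A k l * c k l a)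
    (fun a => (hu a).trans (one_le_pow₀ hs.one_le))
    (fun a => (abs_sum_le_pow hs.one_le _ hcard (n := 4) fun k _ =>
      abs_sum_le_pow hs.one_le _ hcard (n := 3) fun l _ => by
        rw [abs_mul, pow_succ]
        exact mul_le_mul (hY.combo_entry_le hu k l) (hY.coeff_le k l a) (abs_nonneg _)
          (pow_pos hs.pos 2).le).trans (pow_le_pow_right₀ hs.one_le (by norm_num)))
    (by
      simp only [sum_smul_sum, sum_mul_smul, hY.coeff_sum]
      rw [sum_mul_symmUnit A hsymm]) i j
  simpa only [polyCombo_sum, polyCombo_smul] using h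

/-- In the expansion of `Q_mu` only the units for `(i, j)` and `(j, i)` reach position `(i, j)`;
they have the same image, hence the factor 2. -/
theorem firstRow_expansion {i j : Fin r} (hij : i ≠ j) :
    BigO E K (√η) 9 95 (polyCombo Y mu i j -
      C (2 * (∑ a, mu a • Qs a) i j) * polyCombo Y (c i j) i j) := by
  have hs := hY.scale
  have h1 := (hY.expansion hY.mu_le i j).weaken hs hY.eta_le_sqrt
  set A := ∑ a, mu a • Qs a with hA
  have hsymm : ∀ i j, A i j = A j i := fun i j => by
    simp only [hA, Matrix.sum_apply, Matrix.smul_apply, hY.symm_truth _ i j]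
  set G := polyCombo Y (c i j) i j with hG
  have h2 : BigO E K (√η) 9 94 (∑ k, ∑ l, C (A k l) * (polyCombo Y (c k l) i j -
      C (if (i = l ∧ j = k) ∨ (i = k ∧ j = l) then 1 else 0) * G)) := by
    refine hY.sum_r (Real.sqrt_nonneg η) fun k => hY.sum_r (Real.sqrt_nonneg η) fun l => ?_
    have hb := BigO.const (σ := σ) hs (hY.combo_entry_le hY.mu_le k l)
    refine (hb.mul_left (?_ : BigO E K (√η) 9 90 _)).le hs (by norm_num) (by norm_num)
    by_cases hkl : k = l
    · subst hkl
      have h3 := hY.unit_diag k i j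
      rw [symmUnit_self, Matrix.single_apply, if_neg (fun h => hij (h.1.symm.trans h.2))] at h3
      rw [if_neg]
      · exact (h3.congr (by rw [C_0, zero_mul])).le hs (by norm_num) (by norm_num)
      · rintro (h | h) <;> exact hij (h.1.trans h.2.symm)
    · have hz : BigO E K (√η) 9 90 (0 : MvPolynomial σ ℝ) :=
        (BigO.zero hs (Real.sqrt_nonneg η)).le hs (by norm_num) (by norm_num)
      split_ifs with h
      · rcases h with ⟨rfl, rfl⟩ | ⟨rfl, rfl⟩
        · exact hz.congr (by rw [hG, hY.coeff_symm j i, C_1, one_mul, sub_self])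
        · exact hz.congr (by rw [hG, C_1, one_mul, sub_self])
      · rw [C_0, zero_mul, sub_zero]
        exact hY.unit_offdiag_small hkl (fun h' => h (Or.inr h')) (fun h' => h (Or.inl h'))
  refine ((h1.add hs h2).congr ?_).le hs (by norm_num) (by norm_num)
  have e := congrArg (C : ℝ → MvPolynomial σ ℝ) (ApproxSolution.sum_mul_indicator A hsymm i j)
  rw [if_neg hij] at e
  simp only [Algebra.algebraMap_self, RingHom.id_apply, map_sum, C_mul] at e
  simp only [mul_sub, Finset.sum_sub_distrib, ← mul_assoc]
  simp only [← Finset.sum_mul]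
  rw [C_mul, e]
  ring

theorem sqrt_le_fourthRoot : √η ≤ √(√η) := by
  have h1 : √η ≤ 1 := by simpa using hY.eta_le_one
  exact Real.le_sqrt_of_sq_le (by nlinarith [Real.sqrt_nonneg η])

/-- The nonnegativity of the first row of `Q_mu` determines the sign of the scalars. -/
theorem scalar_firstRow {i j : Fin r} (hi : i.val = 0) (hij : i < j) :
    BigO E K (√(√η)) 11 121 (polyCombo Y (c i j) i j - C (1 / 2)) := by
  have hs := hY.scale
  set A := (∑ a, mu a • Qs a) i j with hA
  have hA1 : 1 ≤ K * A := hY.mu_firstRow i j hi hij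
  have hA0 : 0 < A := pos_of_mul_pos_right (by linarith) hs.pos.le
  set G := polyCombo Y (c i j) i j with hG
  have hGb : BigO E K 1 1 8 G := hY.unit_bounded i j i j
  have hq : BigO E K 1 1 9 (G - C (1 / 2)) :=
    (hGb.sub hs (BigO.const (n := 0) hs (by norm_num [abs_le]))).le hs
      (by norm_num) (by norm_num)
  -- The polynomial here is `(G - 1/2)² (G + 1/2)`. Once `(G - 1/2)² G` is known to be nearly
  -- nonnegative, subtracting it leaves `(G - 1/2)² / 2`, which must then be small.
  have h1 : BigO E K (√η) 11 115 ((G ^ 2 - C (1 / 4)) * (G - C (1 / 2))) :=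
    (hY.scalar_sq hij.ne).mul hq
  have h2 : BigO E K (√η) 11 113 ((polyCombo Y mu i j - C (2 * A) * G) *
      ((G - C (1 / 2)) * (G - C (1 / 2)))) :=
    (hY.firstRow_expansion hij.ne).mul (hq.mul hq)
  refine BigO.of_sq hs (Real.sqrt_nonneg _) (Real.sq_sqrt (Real.sqrt_nonneg η))
    (hq.degree.trans (by norm_num)) fun p hp => ?_
  have hX : 0 ≤ E (p ^ 2) := hs.pseudo.nonneg_sq (by omega)
  have h3 := (abs_le.mp (h1.abs_le hs hp)).2
  have h4 := (abs_le.mp (h2.abs_le hs hp)).2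
  have h5 := hY.poly_firstRow i j hi (p ^ 2 * (G - C (1 / 2)) ^ 2)
    ((sq_isSumSq p).mul (sq_isSumSq _)) (by
      have := totalDegree_mul_le (totalDegree_sq_le (le_refl p.totalDegree))
        (totalDegree_sq_le hq.degree)
      omega)
  set x := E (p ^ 2 * (G - C (1 / 2)) ^ 2 * G) with hx
  have e1 : p ^ 2 * ((polyCombo Y mu i j - C (2 * A) * G) *
      ((G - C (1 / 2)) * (G - C (1 / 2)))) =
      p ^ 2 * (G - C (1 / 2)) ^ 2 * polyCombo Y mu i j -
        (2 * A) • (p ^ 2 * (G - C (1 / 2)) ^ 2 * G) := by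
    rw [smul_eq_C_mul]; ring
  have e2 : (1 / 2 : ℝ) • (p ^ 2 * (G - C (1 / 2)) ^ 2) =
      p ^ 2 * ((G ^ 2 - C (1 / 4)) * (G - C (1 / 2))) * (-1) +
        (2 : ℝ) • (p ^ 2 * ((G ^ 2 - C (1 / 4)) * (G - C (1 / 2)))) -
        p ^ 2 * (G - C (1 / 2)) ^ 2 * G := by
    have e3 : (C (1 / 4) : MvPolynomial σ ℝ) = C (1 / 2) * C (1 / 2) := by
      rw [← C_mul]; norm_num
    rw [smul_eq_C_mul, smul_eq_C_mul, e3, map_ofNat]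
    ring
  rw [e1, map_sub, map_smul, smul_eq_mul] at h4
  have e4 := congrArg E e2
  rw [map_sub, map_add, map_smul, map_smul, mul_neg_one, map_neg, smul_eq_mul, smul_eq_mul] at e4
  -- The constraint gives near-nonnegativity with `Q_mu` in place of `G`; replacing `Q_mu` by `2 * A
  -- * G` and dividing by `A ≥ 1 / K` costs one power of `K`.
  have h6 : -x ≤ K ^ 114 * √η * E (p ^ 2) := by
    have hpos : 0 ≤ K ^ 114 * √η * E (p ^ 2) :=
      mul_nonneg (mul_nonneg (pow_pos hs.pos _).le (Real.sqrt_nonneg _)) hX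
    by_cases hx0 : 0 ≤ -x
    · calc -x ≤ K * A * -x := le_mul_of_one_le_left hx0 hA1
        _ ≤ K * (2 * A * -x) := by
          nlinarith [mul_nonneg hs.pos.le (mul_nonneg hA0.le hx0)]
        _ ≤ K * (K ^ 113 * √η * E (p ^ 2)) :=
          mul_le_mul_of_nonneg_left (by linarith) hs.pos.le
        _ = _ := by ring
    · linarith
  set y := √η * E (p ^ 2) with hy
  have hy0 : 0 ≤ y := mul_nonneg (Real.sqrt_nonneg _) hX
  rw [mul_assoc, ← hy] at h3 h6 ⊢
  have h7 : K ^ 114 * y ≤ K ^ 115 * y :=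
    mul_le_mul_of_nonneg_right (pow_le_pow_right₀ hs.one_le (by norm_num)) hy0
  have h8 : 4 * (K ^ 115 * y) ≤ K ^ 121 * y := by
    rw [← mul_assoc]
    refine mul_le_mul_of_nonneg_right ?_ hy0
    calc 4 * K ^ 115 ≤ K * K ^ 115 :=
          mul_le_mul_of_nonneg_right hs.four_le (pow_pos hs.pos _).le
      _ = K ^ 116 := by ring
      _ ≤ K ^ 121 := pow_le_pow_right₀ hs.one_le (by norm_num)
  linarith

/-- `symmUnit_jordan_path` read at `(j, k)`: in one order of the factors only the path through `z`
survives, in the other nothing does. -/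
theorem scalar_path {z j k : Fin r} (hj : z ≠ j) (hk : z ≠ k) (hjk : j ≠ k) :
    BigO E K (√η) 10 102 (polyCombo Y (c z j) z j * polyCombo Y (c z k) z k -
      C (1 / 2) * polyCombo Y (c j k) j k) := by
  have hs := hY.scale
  have h1 := (hY.jordan (w := fun a => 1 / 4 * c j k a) (hY.coeff_le_pow z j)
    (hY.coeff_le_pow z k)
    (fun a => by
      rw [abs_mul]
      exact (mul_le_of_le_one_left (abs_nonneg _) (by norm_num [abs_le])).trans
        (hY.coeff_le_pow j k a))
    (by rw [sum_mul_smul, hY.coeff_sum, hY.coeff_sum, hY.coeff_sum,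
      symmUnit_jordan_path hj hk hjk]) j k).weaken hs hY.eta_le_sqrt
  rw [polyCombo_smul] at h1
  have h2 : BigO E K (√η) 10 99
      (∑ m, polyCombo Y (c z k) j m * polyCombo Y (c z j) m k) :=
    hY.sum_r (Real.sqrt_nonneg η) fun m =>
      (hY.unit_offdiag_small hk (fun h => hj h.1.symm) (fun h => hjk h.1)).mul
        (hY.unit_bounded z j m k)
  have h3 : BigO E K (√η) 10 99
      (∑ m ∈ Finset.univ.erase z, polyCombo Y (c z j) j m * polyCombo Y (c z k) m k) := by
    refine BigO.sum hs _ ?_ (Real.sqrt_nonneg η) fun m hm => ?_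
    · refine le_trans ?_ hY.card_r
      exact_mod_cast (Finset.card_le_univ _).trans_eq (Fintype.card_fin r)
    · exact (hY.unit_offdiag_small hj (fun h => hj h.1.symm)
        (fun h => Finset.ne_of_mem_erase hm h.2)).mul (hY.unit_bounded z k m k)
  refine (((h1.sub hs h2).sub hs h3).congr ?_).le hs (by norm_num) (by norm_num)
  have e3 : (2 : MvPolynomial σ ℝ) * C (1 / 4) = C (1 / 2) := by
    rw [← map_ofNat C 2, ← C_mul]; norm_num
  rw [Matrix.add_apply, Matrix.mul_apply, Matrix.mul_apply,
    ← Finset.add_sum_erase _ (fun m => polyCombo Y (c z j) j m * polyCombo Y (c z k) m k)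
      (Finset.mem_univ z), hY.polyCombo_symm (c z j) j z]
  linear_combination (-polyCombo Y (c j k) j k) * e3

/-- The sign constraint settles pairs containing the index 0; any other pair is joined through 0 by
`scalar_path`. -/
theorem scalar_close {i j : Fin r} (hij : i ≠ j) :
    BigO E K (√(√η)) 12 133 (polyCombo Y (c i j) i j - C (1 / 2)) := by
  have hs := hY.scale
  obtain ⟨z, hz⟩ : ∃ z : Fin r, z.val = 0 := ⟨⟨0, by have := i.2; omega⟩, rfl⟩
  have hlt : ∀ {k : Fin r}, z ≠ k → z < k := fun {k} h => by
    rw [Fin.lt_def]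
    have : z.val ≠ k.val := fun h' => h (Fin.ext h')
    omega
  by_cases hi : z = i
  · subst hi
    exact (hY.scalar_firstRow hz (hlt hij)).le hs (by norm_num) (by norm_num)
  by_cases hj : z = j
  · subst hj
    rw [hY.coeff_symm, hY.polyCombo_symm]
    exact (hY.scalar_firstRow hz (hlt hi)).le hs (by norm_num) (by norm_num)
  · have h1 := (hY.scalar_path hi hj hij).weaken hs hY.sqrt_le_fourthRoot
    have h2 := BigO.mul_sub_mul hs (hY.scalar_firstRow hz (hlt hi))
      (hY.scalar_firstRow hz (hlt hj)) (BigO.const (n := 0) hs (by norm_num [abs_le]))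
      (hY.unit_bounded z j z j)
    refine (BigO.of_const_mul (m := 1) (a := 1 / 2) hs (by norm_num) ?_
      ((h2.sub hs h1).congr ?_)).le hs (by norm_num) (by norm_num)
    · norm_num
      linarith [hs.four_le]
    · ring

theorem unit_close (i j k l : Fin r) :
    BigO E K (√(√η)) 12 133 (polyCombo Y (c i j) k l - C (symmUnit i j k l)) := by
  have hs := hY.scale
  by_cases hij : i = j
  · subst hij
    exact ((hY.unit_diag i k l).weaken hs hY.sqrt_le_fourthRoot).le hs (by norm_num) (by norm_num)
  · by_cases h1 : k = i ∧ l = j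
    · obtain ⟨rfl, rfl⟩ := h1
      refine (hY.scalar_close hij).congr ?_
      rw [symmUnit_apply, if_pos ⟨rfl, rfl⟩, if_neg (fun h => hij h.2), add_zero, mul_one]
    · by_cases h2 : k = j ∧ l = i
      · obtain ⟨rfl, rfl⟩ := h2
        refine (hY.scalar_close hij).congr ?_
        rw [symmUnit_apply, if_neg (fun h => hij h.1), if_pos ⟨rfl, rfl⟩, zero_add, mul_one,
          hY.polyCombo_symm]
      · refine ((((hY.unit_offdiag_small hij h1 h2).weaken hs hY.sqrt_le_fourthRoot).congr ?_).le
          hs (by norm_num) (by norm_num))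
        rw [symmUnit_apply, if_neg (fun h => h1 ⟨h.1.symm, h.2.symm⟩),
          if_neg (fun h => h2 ⟨h.1.symm, h.2.symm⟩), add_zero, mul_zero, C_0, sub_zero]

/-- The matrices `Y a` are close to the ground truth. -/
theorem close (b : Fin d) (i j : Fin r) :
    BigO E K (√(√η)) 12 139 (Y b i j - C (Qs b i j)) := by
  have hs := hY.scale
  set u : Fin d → ℝ := fun a => if a = b then 1 else 0 with hu
  have hu1 : ∀ a, |u a| ≤ 1 := fun a => by
    simp only [hu]
    split_ifs <;> simp
  have huQ : ∑ a, u a • Qs a = Qs b := by simp [hu]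
  have h1 := ((hY.expansion hu1 i j).weaken hs hY.eta_le_sqrt).weaken hs hY.sqrt_le_fourthRoot
  rw [huQ, polyCombo_single] at h1
  have h2 : BigO E K (√(√η)) 12 136 (∑ k, ∑ l, C (Qs b k l) *
      (polyCombo Y (c k l) i j - C (symmUnit k l i j))) :=
    hY.sum_r (Real.sqrt_nonneg _) fun k => hY.sum_r (Real.sqrt_nonneg _) fun l =>
      ((BigO.const (n := 1) hs (by simpa using hY.entry_le b k l)).mul_left
        (hY.unit_close k l i j)).le hs (by norm_num) (by norm_num)
  refine ((h1.add hs h2).congr ?_).le hs (by norm_num) (by norm_num)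
  have e := congrArg (C : ℝ → MvPolynomial σ ℝ)
    (congrFun (congrFun (sum_mul_symmUnit (Qs b) (hY.symm_truth b)) i) j)
  simp only [Matrix.sum_apply, Matrix.smul_apply, smul_eq_mul, map_sum, C_mul] at e
  simp only [mul_sub, Finset.sum_sub_distrib, e]
  ring

end GaugedSolution

end OffDiagonalUnits

/-! ### Pseudo-solutions of the program are approximate solutions -/

section Program

variable {σ : Type} {E : MvPolynomial σ ℝ →ₗ[ℝ] ℝ} {P : PolyProgram σ}

/-- `p ^ 2 * q ^ 2` is a multiple of `q`, so multiplication by `q` is zero in the seminorm and any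
`b ≥ 0` serves. -/
theorem Satisfies.opBound_of_eq (hE : IsPseudoExpectation 96 E) (hP : Satisfies 96 E P) {k : ℕ}
    {b : ℝ} (hb : 0 ≤ b) {q : MvPolynomial σ ℝ} (hq : q ∈ P.eqs) (hk : q.totalDegree ≤ k) :
    OpBound E k b q where
  nonneg := hb
  degree := hk
  bound p hp := by
    have h : E (p ^ 2 * q ^ 2) = 0 := by
      refine hP.eq _ (Submodule.subset_span ⟨?_, p ^ 2 * q, q, hq, by ring⟩)
      have := totalDegree_mul_le (totalDegree_sq_le (le_refl p.totalDegree))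
        (totalDegree_sq_le hk)
      omega
    rw [h]
    exact mul_nonneg (sq_nonneg b) (hE.nonneg_sq (by omega))

theorem Satisfies.nonneg_of_ineq (hP : Satisfies 96 E P) {g s : MvPolynomial σ ℝ}
    (hg : g ∈ P.ineqs) (hs : IsSumSq s) (hdeg : (s * g).totalDegree ≤ 96) : 0 ≤ E (s * g) := by
  have h := hP.ineq {g} (by simpa using hg) s hs (by simpa using hdeg)
  simpa using h

theorem Satisfies.opBound_of_sum_sq (hE : IsPseudoExpectation 96 E) (hP : Satisfies 96 E P)
    {ι κ : Type*} [Fintype ι] [Fintype κ] {f : ι → κ → MvPolynomial σ ℝ} {b c : ℝ} (hb : 0 ≤ b)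
    (hc : c = b ^ 2) (hf : ∀ i j, (f i j).totalDegree ≤ 1)
    (h : C c - ∑ i, ∑ j, f i j ^ 2 ∈ P.ineqs) (i : ι) (j : κ) : OpBound E 1 b (f i j) where
  nonneg := hb
  degree := hf i j
  bound p hp := by
    classical
    rw [← Fintype.sum_prod_type' fun i j => f i j ^ 2] at h
    have hdeg : ∀ x : ι × κ, (f x.1 x.2 ^ 2).totalDegree ≤ 2 := fun x => totalDegree_sq_le (hf _ _)
    have h1 := hP.nonneg_of_ineq h (sq_isSumSq p) (by
      have := totalDegree_mul_le (totalDegree_sq_le (le_refl p.totalDegree))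
        (totalDegree_sub_le (k := 2) (by simp) (totalDegree_finsetSum_le fun x _ => hdeg x))
        (p := p ^ 2) (q := C c - ∑ x : ι × κ, f x.1 x.2 ^ 2)
      omega)
    have h2 := hE.nonneg_mul_sum_sq (p := p) (f := fun x : ι × κ => f x.1 x.2)
      (Finset.univ.erase (i, j))
      fun x _ => (totalDegree_mul_le le_rfl (hf _ _)).trans hp
    have e : p ^ 2 * (C c - ∑ x : ι × κ, f x.1 x.2 ^ 2) =
        c • p ^ 2 - p ^ 2 * f i j ^ 2 - p ^ 2 * ∑ x ∈ Finset.univ.erase (i, j), f x.1 x.2 ^ 2 := by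
      rw [← Finset.add_sum_erase _ _ (Finset.mem_univ (i, j)), smul_eq_C_mul]
      ring
    rw [e, map_sub, map_sub, map_smul, smul_eq_mul] at h1
    rw [← hc]
    linarith

/-- The product of the two constraints is `η² - (y - s)²`. -/
theorem Satisfies.opBound_of_twoSided (hP : Satisfies 96 E P)
    {y : MvPolynomial σ ℝ} {s η : ℝ} (hη : 0 ≤ η) {k : ℕ} (hy : y.totalDegree ≤ k)
    (hl : y - C s + C η ∈ P.ineqs) (hu : C η - (y - C s) ∈ P.ineqs) :
    OpBound E k η (y - C s) where
  nonneg := hη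
  degree := totalDegree_sub_le hy (by simp)
  bound p hp := by
    have hd : (y - C s).totalDegree ≤ k := totalDegree_sub_le hy (by simp)
    have h := hP.ineq {y - C s + C η, C η - (y - C s)} (by
      intro q hq
      rcases Multiset.mem_cons.mp hq with rfl | hq
      · exact hl
      · rw [Multiset.mem_singleton.mp hq]; exact hu) (p ^ 2) (sq_isSumSq p) (by
        rw [Multiset.insert_eq_cons, Multiset.prod_cons, Multiset.prod_singleton]
        have := totalDegree_mul_le (totalDegree_sq_le (le_refl p.totalDegree))
          (totalDegree_mul_le (totalDegree_add_le hd (by simp : (C η).totalDegree ≤ k))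
            (totalDegree_sub_le (by simp : (C η).totalDegree ≤ k) hd))
        omega)
    rw [Multiset.insert_eq_cons, Multiset.prod_cons, Multiset.prod_singleton] at h
    have e : p ^ 2 * ((y - C s + C η) * (C η - (y - C s))) =
        (η ^ 2) • p ^ 2 - p ^ 2 * (y - C s) ^ 2 := by
      rw [smul_eq_C_mul, C_pow]; ring
    rw [e, map_sub, map_smul, smul_eq_mul] at h
    linarith

end Program

/-! ### Verification for the tensor ring program. -/

/-- The matrix of indeterminates `Q a` with the entries below the diagonal replaced by those
above it. -/
def symmVar {d r : ℕ} (a : Fin d) : Matrix (Fin r) (Fin r) (MvPolynomial (RingVar d r) ℝ) :=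
  Matrix.of fun i j => X (RingVar.Q a (min i j) (max i j))

theorem symmVar_of_le {d r : ℕ} (a : Fin d) {i j : Fin r} (h : i ≤ j) :
    symmVar a i j = varQ a i j := by
  simp [symmVar, varQ, h]

theorem varCombo_apply {d r : ℕ} (u : EuclideanSpace ℝ (Fin d)) (i j : Fin r) :
    varCombo u i j = ∑ a, C (u a) * varQ a i j := by
  simp [varCombo, Matrix.sum_apply, smul_eq_C_mul]

theorem polyCombo_symmVar_of_le {d r : ℕ} (u : EuclideanSpace ℝ (Fin d)) {i j : Fin r}
    (h : i ≤ j) : polyCombo symmVar (fun a => u a) i j = varCombo u i j := by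
  rw [polyCombo_apply, varCombo_apply]
  simp only [symmVar_of_le _ h]

theorem abs_le_frobNorm {r : ℕ} (A : Matrix (Fin r) (Fin r) ℝ) (i j : Fin r) :
    |A i j| ≤ frobNorm A := by
  refine Real.abs_le_sqrt ?_
  calc A i j ^ 2 ≤ ∑ l, A i l ^ 2 :=
        Finset.single_le_sum (f := fun l => A i l ^ 2) (fun l _ => sq_nonneg _) (Finset.mem_univ j)
    _ ≤ _ := Finset.single_le_sum (f := fun k => ∑ l, A k l ^ 2)
        (fun k _ => Finset.sum_nonneg fun l _ => sq_nonneg _) (Finset.mem_univ i)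

theorem frobNorm_le {r : ℕ} {A : Matrix (Fin r) (Fin r) ℝ} {b : ℝ} (hb : 0 ≤ b)
    (h : ∀ i j, |A i j| ≤ b) : frobNorm A ≤ r * b := by
  refine Real.sqrt_le_iff.mpr ⟨by positivity, ?_⟩
  have h1 : ∀ i j, A i j ^ 2 ≤ b ^ 2 := fun i j => sq_le_sq' (by linarith [(abs_le.mp (h i j)).1])
    (abs_le.mp (h i j)).2
  calc ∑ i, ∑ j, A i j ^ 2 ≤ ∑ _i : Fin r, ∑ _j : Fin r, b ^ 2 :=
        Finset.sum_le_sum fun i _ => Finset.sum_le_sum fun j _ => h1 i j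
    _ = (r * b) ^ 2 := by simp; ring

theorem totalDegree_varQ {d r : ℕ} (a : Fin d) (i j : Fin r) :
    (varQ a i j : MvPolynomial (RingVar d r) ℝ).totalDegree ≤ 1 := by
  simp [varQ]

theorem totalDegree_varL {d r : ℕ} (p : UpperPairs r) (a : Fin d) :
    (varL p a : MvPolynomial (RingVar d r) ℝ).totalDegree ≤ 1 := by
  simp [varL]

theorem totalDegree_varCombo {d r : ℕ} (u : EuclideanSpace ℝ (Fin d)) (i j : Fin r) :
    (varCombo u i j).totalDegree ≤ 1 := by
  rw [varCombo_apply]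
  exact totalDegree_finsetSum_le fun a _ =>
    (totalDegree_mul_le (k := 0) (by simp) (totalDegree_varQ a i j)).trans (by norm_num)

section Ring

variable {d r : ℕ} {Qs : Fin d → Matrix (Fin r) (Fin r) ℝ} {β κ υ η K : ℝ}
  {S : Fin d → Fin d → ℝ} {T : Fin d → Fin d → Fin d → ℝ} {lam mu : EuclideanSpace ℝ (Fin d)}
  {E : MvPolynomial (RingVar d r) ℝ →ₗ[ℝ] ℝ}

theorem opBound_varQ (hE : IsPseudoExpectation 96 E)
    (hP : Satisfies 96 E (ringProgram lam mu S T β κ η)) (hβ : 0 ≤ β) (a : Fin d) (i j : Fin r) :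
    OpBound E 1 β (varQ a i j) :=
  hP.opBound_of_sum_sq hE hβ rfl (totalDegree_varQ a) (RingIneq.bounded_Q a) i j

/-- `symmVar` makes symmetry an identity of polynomials, as `ApproxSolution.symm` requires; the
symmetry constraint makes the change invisible to `E`. -/
theorem opBound_symmVar_sub (hE : IsPseudoExpectation 96 E)
    (hP : Satisfies 96 E (ringProgram lam mu S T β κ η)) {b : ℝ} (hb : 0 ≤ b) (a : Fin d)
    (i j : Fin r) : OpBound E 1 b (symmVar a i j - varQ a i j) := by
  rcases le_total i j with h | h
  · rw [symmVar_of_le a h, sub_self, ← C_0]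
    exact OpBound.const hE (by simpa using hb) 1
  · have e : symmVar a i j = (varQ a j i : MvPolynomial (RingVar d r) ℝ) := by
      simp [symmVar, varQ, h]
    rw [e]
    exact hP.opBound_of_eq hE hb (RingEq.symm a j i)
      (totalDegree_sub_le (totalDegree_varQ a j i) (totalDegree_varQ a i j))

theorem totalDegree_varQ_mul (a b : Fin d) (i j : Fin r) :
    ((varQ a * varQ b : Matrix _ _ (MvPolynomial (RingVar d r) ℝ)) i j).totalDegree ≤ 2 := by
  rw [Matrix.mul_apply]
  exact totalDegree_finsetSum_le fun k _ =>
    totalDegree_mul_le (totalDegree_varQ a i k) (totalDegree_varQ b k j)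

theorem opBound_second (hP : Satisfies 96 E (ringProgram lam mu S T β κ η)) (hη : 0 ≤ η)
    (a b : Fin d) : OpBound E 2 η ((varQ a * varQ b).trace - C (S a b)) := by
  refine hP.opBound_of_twoSided hη ?_ (RingIneq.second_lower a b) (RingIneq.second_upper a b)
  rw [Matrix.trace]
  refine totalDegree_finsetSum_le fun i _ => ?_
  rw [Matrix.diag_apply]
  exact totalDegree_varQ_mul a b i i

theorem opBound_third (hP : Satisfies 96 E (ringProgram lam mu S T β κ η)) (hη : 0 ≤ η)
    (a b c : Fin d) : OpBound E 3 η ((varQ a * varQ b * varQ c).trace - C (T a b c)) := by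
  refine hP.opBound_of_twoSided hη ?_ (RingIneq.third_lower a b c) (RingIneq.third_upper a b c)
  rw [Matrix.trace]
  refine totalDegree_finsetSum_le fun i _ => ?_
  rw [Matrix.diag_apply, Matrix.mul_apply]
  exact totalDegree_finsetSum_le fun j _ =>
    totalDegree_mul_le (totalDegree_varQ_mul a b i j) (totalDegree_varQ c j i)

theorem bigO_varQ (hs : Scale E K) (hP : Satisfies 96 E (ringProgram lam mu S T β κ η))
    (hβ : 0 ≤ β) (hβK : β ≤ K) (a : Fin d) (i j : Fin r) : BigO E K 1 1 1 (varQ a i j) :=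
  (opBound_varQ hs.pseudo hP hβ a i j).mono hs.pseudo le_rfl (by simpa using hβK)

theorem bigO_symmVar (hs : Scale E K) (hP : Satisfies 96 E (ringProgram lam mu S T β κ η))
    (hβ : 0 ≤ β) (hβK : β ≤ K) (a : Fin d) (i j : Fin r) : BigO E K 1 1 1 (symmVar a i j) :=
  bigO_varQ hs hP hβ hβK a (min i j) (max i j)

theorem bigO_symmVar_sub (hs : Scale E K) (hP : Satisfies 96 E (ringProgram lam mu S T β κ η))
    {δ : ℝ} (hδ : 0 ≤ δ) (a : Fin d) (i j : Fin r) :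
    BigO E K δ 1 0 (symmVar a i j - varQ a i j) :=
  opBound_symmVar_sub hs.pseudo hP (by simpa using hδ) a i j

theorem bigO_symmVar_mul_sub (hs : Scale E K)
    (hP : Satisfies 96 E (ringProgram lam mu S T β κ η)) (hr : (r : ℝ) ≤ K) (hβ : 0 ≤ β)
    (hβK : β ≤ K) (hη : 0 ≤ η) (a b : Fin d) (i j : Fin r) :
    BigO E K η 2 3
      ((symmVar a * symmVar b : Matrix _ _ (MvPolynomial (RingVar d r) ℝ)) i j -
        (varQ a * varQ b : Matrix _ _ (MvPolynomial (RingVar d r) ℝ)) i j) := by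
  rw [Matrix.mul_apply, Matrix.mul_apply]
  exact BigO.sum_sub_sum hs _ (by simpa using hr) hη fun k _ =>
    (BigO.mul_sub_mul hs (bigO_symmVar_sub hs hP hη a i k) (bigO_symmVar_sub hs hP hη b k j)
      (bigO_varQ hs hP hβ hβK a i k) (bigO_symmVar hs hP hβ hβK b k j)).le hs
        (by norm_num) (by norm_num)

theorem bigO_second (hs : Scale E K) (hP : Satisfies 96 E (ringProgram lam mu S T β κ η))
    (hr : (r : ℝ) ≤ K) (hβ : 0 ≤ β) (hβK : β ≤ K) (hη : 0 ≤ η) (hM : MomentsMatch Qs S T η)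
    (a b : Fin d) :
    BigO E K η 2 5 ((symmVar a * symmVar b).trace - C (Qs a * Qs b).trace) := by
  have h1 : BigO E K η 2 4 ((symmVar a * symmVar b).trace - (varQ a * varQ b).trace) :=
    BigO.sum_sub_sum hs _ (by simpa using hr) hη fun i _ =>
      bigO_symmVar_mul_sub hs hP hr hβ hβK hη a b i i
  have h2 : BigO E K η 2 0 ((varQ a * varQ b).trace - C (S a b)) :=
    (opBound_second hP hη a b).mono hs.pseudo le_rfl (by simp)
  have h3 : BigO E K η 0 0 (C (S a b - (Qs a * Qs b).trace) : MvPolynomial (RingVar d r) ℝ) :=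
    OpBound.const hs.pseudo (by simpa using hM.second a b) 0
  refine ((h1.add hs (h2.add hs h3)).congr ?_).le hs (by norm_num) (by norm_num)
  rw [C_sub]
  ring

theorem bigO_third (hs : Scale E K) (hP : Satisfies 96 E (ringProgram lam mu S T β κ η))
    (hr : (r : ℝ) ≤ K) (hβ : 0 ≤ β) (hβK : β ≤ K) (hη : 0 ≤ η) (hM : MomentsMatch Qs S T η)
    (a b c : Fin d) : BigO E K η 3 8
      ((symmVar a * symmVar b * symmVar c).trace - C (Qs a * Qs b * Qs c).trace) := by
  have hr' : ((Finset.univ : Finset (Fin r)).card : ℝ) ≤ K := by simpa using hr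
  have h0 : ∀ i j, BigO E K 1 2 3
      ((varQ a * varQ b : Matrix _ _ (MvPolynomial (RingVar d r) ℝ)) i j) := fun i j => by
    rw [Matrix.mul_apply]
    exact BigO.sum hs _ hr' zero_le_one fun k _ =>
      (bigO_varQ hs hP hβ hβK a i k).mul (bigO_varQ hs hP hβ hβK b k j)
  have h1 : BigO E K η 3 7
      ((symmVar a * symmVar b * symmVar c).trace - (varQ a * varQ b * varQ c).trace) := by
    refine BigO.sum_sub_sum hs _ hr' hη fun i _ => ?_
    rw [Matrix.diag_apply, Matrix.diag_apply, Matrix.mul_apply (N := symmVar c),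
      Matrix.mul_apply (N := varQ c)]
    exact BigO.sum_sub_sum hs _ hr' hη fun j _ =>
      (BigO.mul_sub_mul hs (bigO_symmVar_mul_sub hs hP hr hβ hβK hη a b i j)
        (bigO_symmVar_sub hs hP hη c j i) (h0 i j) (bigO_symmVar hs hP hβ hβK c j i)).le hs
          (by norm_num) (by norm_num)
  have h2 : BigO E K η 3 0 ((varQ a * varQ b * varQ c).trace - C (T a b c)) :=
    (opBound_third hP hη a b c).mono hs.pseudo le_rfl (by simp)
  have h3 : BigO E K η 0 0
      (C (T a b c - (Qs a * Qs b * Qs c).trace) : MvPolynomial (RingVar d r) ℝ) :=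
    OpBound.const hs.pseudo (by simpa using hM.third a b c) 0
  refine ((h1.add hs (h2.add hs h3)).congr ?_).le hs (by norm_num) (by norm_num)
  rw [C_sub]
  ring

theorem approxSolution_of_satisfies (hs : Scale E K)
    (hP : Satisfies 96 E (ringProgram lam mu S T β κ η)) (hd : (d : ℝ) ≤ K) (hr : (r : ℝ) ≤ K)
    (hβ : 0 ≤ β) (hβK : β ≤ K) (hκ : 0 < κ) (hκK : 1 / κ ≤ K) (hη : 0 ≤ η)
    (hM : MomentsMatch Qs S T η) :
    ApproxSolution E K η Qs symmVar varL := by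
  have hE := hs.pseudo
  refine ⟨hs, hd, hr, hη, ?_, bigO_symmVar hs hP hβ hβK, ?_, ?_,
    bigO_second hs hP hr hβ hβK hη hM, bigO_third hs hP hr hβ hβK hη hM⟩
  · intro a i j
    simp [symmVar, min_comm, max_comm]
  · intro p a
    have h := hP.opBound_of_sum_sq hE (f := fun p a => varL p a) (b := r / κ) (by positivity)
      (by rw [div_pow]) totalDegree_varL RingIneq.bounded_L p a
    refine OpBound.mono hE h le_rfl ?_
    rw [mul_one, sq, div_eq_mul_one_div]
    exact mul_le_mul hr hκK (by positivity) hs.pos.le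
  · intro i j k l
    have e : ∑ a, varL (toUpper i j) a * symmVar a k l -
        C (if (i = k ∧ j = l) ∨ (i = l ∧ j = k) then 1 else 0) =
        ∑ a, varL (toUpper i j) a * upperMatrix varQ a (toUpper k l) -
          (if toUpper i j = toUpper k l then 1 else 0 : MvPolynomial (RingVar d r) ℝ) := by
      simp only [toUpper_eq_iff, apply_ite (C : ℝ → MvPolynomial (RingVar d r) ℝ), C_0, C_1]
      rfl
    rw [e]
    refine hP.opBound_of_eq hE (mul_nonneg (pow_pos hs.pos 2).le hη)
      (RingEq.leftInverse (toUpper i j) (toUpper k l)) (totalDegree_sub_le ?_ ?_)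
    · exact totalDegree_finsetSum_le fun a _ =>
        totalDegree_mul_le (totalDegree_varL _ a) (totalDegree_varQ a _ _)
    · split_ifs <;> simp

theorem exists_gaugedSolution (hs : Scale E K)
    (hP : Satisfies 96 E (ringProgram lam mu S T β κ η)) (hd : (d : ℝ) ≤ K) (hr : (r : ℝ) ≤ K)
    (hβ : 0 ≤ β) (hβK : β ≤ K) (hκ : 0 < κ) (hκK : 1 / κ ≤ K) (hυ : 0 < υ) (hυK : 1 / υ ≤ K)
    (hη : 0 ≤ η) (hη1 : η ≤ 1) (hsymm : ∀ a, (Qs a).IsSymm) (hM : MomentsMatch Qs S T η)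
    (hA : RingAssumption Qs β κ) (hlam : lam ∈ Metric.sphere (0 : EuclideanSpace ℝ (Fin d)) 1)
    (hmu : mu ∈ Metric.sphere (0 : EuclideanSpace ℝ (Fin d)) 1)
    (hnd : NonDegenerate υ lam mu Qs) (hg : GaugeFixed lam mu Qs) :
    ∃ c, GaugedSolution E K η Qs symmVar varL c (fun a => lam a) (fun a => mu a) := by
  obtain ⟨c, hc1, hc2, hc3⟩ := exists_dual_coefficients hκ hsymm hA
  obtain ⟨hgap, hrow⟩ := gauge_gaps hυ hnd hg
  have hE := hs.pseudo
  have hunit : ∀ {x : EuclideanSpace ℝ (Fin d)}, x ∈ Metric.sphere 0 1 → ∀ a, |x a| ≤ 1 :=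
    fun {x} hx a => by
      have h := PiLp.norm_apply_le x a
      rwa [Real.norm_eq_abs, mem_sphere_zero_iff_norm.mp hx] at h
  have hυ' : ∀ {x : ℝ}, υ ≤ x → 1 ≤ K * x := fun {x} hx => by
    calc (1 : ℝ) = 1 / υ * υ := by field_simp
      _ ≤ K * x := mul_le_mul hυK hx hυ.le hs.pos.le
  have hdiag : ∀ i j, i ≠ j → BigO E K η 1 1 (polyCombo symmVar (fun a => lam a) i j) := by
    have h : ∀ i j : Fin r, i < j → BigO E K η 1 1 (polyCombo symmVar (fun a => lam a) i j) :=
      fun i j hij => by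
        rw [polyCombo_symmVar_of_le lam hij.le]
        exact hP.opBound_of_eq hE (mul_nonneg (pow_pos hs.pos 1).le hη)
          (RingEq.diag i j hij.ne) (totalDegree_varCombo lam i j)
    intro i j hij
    rcases hij.lt_or_gt with h' | h'
    · exact h i j h'
    · refine (h j i h').congr ?_
      simp only [polyCombo_apply, symmVar, Matrix.of_apply, min_comm, max_comm]
  refine ⟨c, ⟨approxSolution_of_satisfies hs hP hd hr hβ hβK hκ hκK hη hM, hη1,
    fun i j a => (hc2 i j a).trans hκK, hc1, hc3, hunit hlam, hunit hmu, fun a i j => ?_,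
    fun a i j => ?_, hg.diag, fun i j hij => hυ' (hgap i j hij), fun i j hi hij => ?_, hdiag,
    fun i j hij s hs1 hs2 => ?_, fun i j hi s hs1 hs2 => ?_⟩⟩
  · exact (abs_le_frobNorm _ i j).trans ((hA.scaling a).trans hβK)
  · exact (hsymm a).apply j i
  · have h := hrow i j
    rw [abs_of_nonneg (hg.firstRow i j hi hij)] at h
    exact hυ' h
  · rw [polyCombo_symmVar_of_le lam le_rfl, polyCombo_symmVar_of_le lam le_rfl]
    refine hP.nonneg_of_ineq (RingIneq.sorted i j hij) hs1 ?_
    have := totalDegree_mul_le hs2 (totalDegree_sub_le (totalDegree_varCombo lam j j)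
      (totalDegree_varCombo lam i i))
    omega
  · have hij : i ≤ j := by rw [Fin.le_def]; omega
    rw [polyCombo_symmVar_of_le mu hij]
    refine hP.nonneg_of_ineq (RingIneq.firstRow i j hi) hs1 ?_
    have := totalDegree_mul_le hs2 (totalDegree_varCombo mu i j)
    omega

theorem OpBound.abs_apply_le (hE : IsPseudoExpectation 96 E) {k : ℕ} {b : ℝ}
    {f : MvPolynomial (RingVar d r) ℝ} (hf : OpBound E k b f) (hk : k ≤ 48) : |E f| ≤ b := by
  have h := hf.abs_le hE (p := 1) (by simp [hk])
  simpa [hE.normalized] using h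

theorem frobNorm_pseudoMean_sub_le (hs : Scale E K)
    (hP : Satisfies 96 E (ringProgram lam mu S T β κ η)) (hd : (d : ℝ) ≤ K) (hr : (r : ℝ) ≤ K)
    (hβ : 0 ≤ β) (hβK : β ≤ K) (hκ : 0 < κ) (hκK : 1 / κ ≤ K) (hυ : 0 < υ) (hυK : 1 / υ ≤ K)
    (hη : 0 ≤ η) (hsymm : ∀ a, (Qs a).IsSymm) (hM : MomentsMatch Qs S T η)
    (hA : RingAssumption Qs β κ) (hlam : lam ∈ Metric.sphere (0 : EuclideanSpace ℝ (Fin d)) 1)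
    (hmu : mu ∈ Metric.sphere (0 : EuclideanSpace ℝ (Fin d)) 1)
    (hnd : NonDegenerate υ lam mu Qs) (hg : GaugeFixed lam mu Qs) (a : Fin d) :
    frobNorm (pseudoMean E a - Qs a) ≤ K ^ 141 * √(√η) := by
  have hE := hs.pseudo
  have hsqrt : 0 ≤ √(√η) := Real.sqrt_nonneg _
  have hentry : ∀ i j, |(pseudoMean E a - Qs a) i j| ≤ K ^ 140 * √(√η) := by
    intro i j
    rw [Matrix.sub_apply, pseudoMean, Matrix.of_apply]
    rcases le_total η 1 with hη1 | hη1
    · obtain ⟨c, hY⟩ := exists_gaugedSolution hs hP hd hr hβ hβK hκ hκK hυ hυK hη hη1 hsymm hM hA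
        hlam hmu hnd hg
      have h1 : BigO E K (√(√η)) 1 0 (symmVar a i j - varQ a i j) :=
        bigO_symmVar_sub hs hP hsqrt a i j
      have h2 := ((hY.close a i j).sub hs h1).le hs (by norm_num : _ ≤ 12) (by norm_num : _ ≤ 140)
      have h3 := OpBound.abs_apply_le hE h2 (by norm_num)
      rw [show symmVar a i j - C (Qs a i j) - (symmVar a i j - varQ a i j) =
        varQ a i j - (Qs a i j) • (1 : MvPolynomial (RingVar d r) ℝ) by
          rw [smul_eq_C_mul]; ring] at h3
      rwa [map_sub, map_smul, hE.normalized, smul_eq_mul, mul_one] at h3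
    -- For `η ≥ 1` the norm bounds alone suffice, since `√(√η) ≥ 1`.
    · have h1 := (opBound_varQ hE hP hβ a i j).abs_apply_le hE (by norm_num)
      have h2 := (abs_le_frobNorm (Qs a) i j).trans (hA.scaling a)
      have h3 : 1 ≤ √(√η) := Real.one_le_sqrt.mpr (Real.one_le_sqrt.mpr hη1)
      calc |E (varQ a i j) - Qs a i j| ≤ β + β := (abs_sub _ _).trans (add_le_add h1 h2)
        _ ≤ K ^ 2 := by nlinarith [hs.four_le]
        _ ≤ K ^ 140 := pow_le_pow_right₀ hs.one_le (by norm_num)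
        _ ≤ _ := le_mul_of_one_le_right (pow_pos hs.pos _).le h3
  calc frobNorm (pseudoMean E a - Qs a) ≤ r * (K ^ 140 * √(√η)) :=
        frobNorm_le (mul_nonneg (pow_pos hs.pos _).le hsqrt) hentry
    _ ≤ K * (K ^ 140 * √(√η)) :=
        mul_le_mul_of_nonneg_right hr (mul_nonneg (pow_pos hs.pos _).le hsqrt)
    _ = _ := by ring

end Ring

end TensorRing

end

/-! ### The main theorem: choice of the polynomial and the exponent. -/

theorem theorem7p5 :
    ∃ (P : MvPolynomial (Fin 5) ℝ) (c : ℝ), 0 < c ∧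
      ∀ (d r : ℕ) (Qs : Fin d → Matrix (Fin r) (Fin r) ℝ) (β κ υ η : ℝ)
        (S : Fin d → Fin d → ℝ) (T : Fin d → Fin d → Fin d → ℝ)
        (lam mu : EuclideanSpace ℝ (Fin d))
        (E : MvPolynomial (TensorRing.RingVar d r) ℝ →ₗ[ℝ] ℝ),
        1 ≤ β → 0 < κ → 0 < υ → 0 ≤ η →
        (∀ a, (Qs a).IsSymm) →
        TensorRing.MomentsMatch Qs S T η →
        TensorRing.RingAssumption Qs β κ →
        lam ∈ Metric.sphere 0 1 → mu ∈ Metric.sphere 0 1 →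
        TensorRing.NonDegenerate υ lam mu Qs →
        TensorRing.GaugeFixed lam mu Qs →
        TensorRing.IsPseudoExpectation 96 E →
        TensorRing.Satisfies 96 E (TensorRing.ringProgram lam mu S T β κ η) →
        ∀ a, TensorRing.frobNorm (TensorRing.pseudoMean E a - Qs a) ≤
          MvPolynomial.eval ![(d : ℝ), (r : ℝ), β, 1 / κ, 1 / υ] P * η ^ c := by
  -- `K` is the sum of all parameters plus 4, so it dominates each of them and is at least 4.
  refine ⟨(X 0 + X 1 + X 2 + X 3 + X 4 + C 4) ^ 141, 1 / 4, by norm_num, ?_⟩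
  intro d r Qs β κ υ η S T lam mu E hβ hκ hυ hη hsymm hM hA hlam hmu hnd hg hE hP a
  have hroot : η ^ (1 / 4 : ℝ) = √(√η) := by
    rw [Real.sqrt_eq_rpow, Real.sqrt_eq_rpow, ← Real.rpow_mul hη]
    norm_num
  have hd : (0 : ℝ) ≤ d := Nat.cast_nonneg d
  have hr : (0 : ℝ) ≤ r := Nat.cast_nonneg r
  have hκ' : 0 ≤ 1 / κ := by positivity
  have hυ' : 0 ≤ 1 / υ := by positivity
  have h := TensorRing.frobNorm_pseudoMean_sub_le (K := d + r + β + 1 / κ + 1 / υ + 4)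
    ⟨hE, by linarith⟩ hP (by linarith) (by linarith) (by linarith) (by linarith) hκ
    (by linarith) hυ (by linarith) hη hsymm hM hA hlam hmu hnd hg a
  rw [hroot]
  simpa using h
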